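/- For a real $n\times d$ matrix $A$ of rank $d\ge 1$ put $\operatorname{dist}^2(x)=\min_{w\in\mathbb R^d}\|Aw-x\|_2^2$ for $x\in\mathbb R^n$, and let $x^{opt}$ be a minimizer of $\operatorname{dist}^2$ over $\{0,1\}^n\setminus\{0\}$. For $r\ge 1$ consider the following randomized algorithm with input $A$ and $r$. (1) Let $A=U\Sigma V^\top$ be a thin singular value decomposition and $p_i=\|U_{(i)}\|_2^2/d$ the normalized leverage scores, where $U_{(i)}$ is the $i$-th row of $U$. Draw $i_1,\dots,i_r$ independently from the distribution $p$; let $S\in\mathbb R^{r\times n}$ be the matrix whose $j$-th row is the $i_j$-th unit vector, $D\in\mathbb R^{r\times r}$ the diagonal matrix with $D_{jj}=1/\sqrt{r\,p_{i_j}}$, $A'=DSA$ and $R=\{i_1,\dots,i_r\}$. (2) Let $T=\{(1,0,\dots,0)^\top\}$. For each $x'\in\{0,1\}^r\setminus\{0\}$ compute a minimizer $w'$ of $\|A'w-Dx'\|_2^2$ and add to $T$ the vector $x\in\{0,1\}^n$ with $x_i=x'_j$ if $i=i_j\in R$, and, for $i\notin R$, $x_i=0$ if $(Aw')_i<\tfrac12$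 and $x_i=1$ otherwise. (If a row is sampled for several $j$ with different values $x'_j$, any of these values may be used as long as $x\ne 0$.) (3) Output a minimizer $x^*$ of $\operatorname{dist}^2$ over $T$. There are absolute constants $C,K>0$ such that for all $n$, $d\ge 1$ and all real $n\times d$ matrices $A$ of rank $d$ the following hold. (a) For every $\epsilon>0$ and every integer $r\ge C\,d\log(d+1)/\min(\epsilon,1)^2$ one has $r\ge d$, and, however ties in the algorithm are broken, with probability at least $2/3$ the output satisfies $x^*\in\{0,1\}^n\setminus\{0\}$ and $$\min_{w}\|Aw-x^*\|_2^2\le(1+\epsilon)\min_{w}\|Aw-x^{opt}\|_2^2 .$$ (b) For every $r\ge d$ the algorithm is carried out by an explicit program for a real-number machine (unit cost for arithmetic operations, square roots, comparisons and steps of control; cost $n$ for drawing an index from a given distribution on $n$ points), one and the same for all inputs, which takes at most $K\,n\,r\,2^r$ steps for every outcome of the random choices. -/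

import Mathlib

open scoped ENNReal

/-! ### Real-RAM programs with a step count -/

/-- The four arithmetic operations of the machine. -/
inductive ArithOp : Type
  | plus
  | minus
  | times
  | divide

/-- Randomized real-RAM programs whose real registers hold values of type `R` and which return a
value of type `α`.  Programs are written uniformly in `R`, so that the only way for them to compute
with real numbers is through the constructors below. -/
inductive Prog (R : Type) (α : Type) : Type
  /-- stop and return -/
  | ret (a : α) : Prog R α
  /-- one step of control: loop counter, test on indices, memory access -/
  | tick (k : Prog R α) : Prog R α
  /-- load a rational constant -/
  | lit (q : ℚ) (k : R → Prog R α) : Prog R α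
  /-- an arithmetic operation -/
  | arith (o : ArithOp) (x y : R) (k : R → Prog R α) : Prog R α
  /-- a square root -/
  | sqrt (x : R) (k : R → Prog R α) : Prog R α
  /-- the comparison `x < y` -/
  | less (x y : R) (k : Bool → Prog R α) : Prog R α
  /-- draw an index `i` with probability `p i` -/
  | sample {n : ℕ} [NeZero n] (p : Fin n → R) (k : Fin n → Prog R α) : Prog R α

namespace Prog

variable {R α β σ : Type}

/-- Sequential composition. -/
def bind : Prog R α → (α → Prog R β) → Prog R β
  | ret a, f => f a
  | tick k, f => tick (bind k f)
  | lit q k, f => lit q fun z => bind (k z) f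
  | arith o x y k, f => arith o x y fun z => bind (k z) f
  | sqrt x k, f => sqrt x fun z => bind (k z) f
  | less x y k, f => less x y fun b => bind (k b) f
  | sample p k, f => sample p fun i => bind (k i) f

instance : Monad (Prog R) where
  pure := ret
  bind := bind

end Prog

/-- The exact meaning of the arithmetic operations over the reals. -/
noncomputable def ArithOp.eval : ArithOp → ℝ → ℝ → ℝ
  | plus, x, y => x + y
  | minus, x, y => x - y
  | times, x, y => x * y
  | divide, x, y => x / y

open Classical in
/-- The random index with probabilities `p`.  (The instruction is only meaningful when `p` is a
probability vector; otherwise it returns the index `0`.) -/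
noncomputable def draw {n : ℕ} [NeZero n] (p : Fin n → ℝ) : PMF (Fin n) :=
  if h : ∑ i, ENNReal.ofReal (p i) = 1 ∧ ∀ i, 0 ≤ p i then
    PMF.ofFintype (fun i => ENNReal.ofReal (p i)) h.1
  else PMF.pure 0

namespace Prog

variable {R α β σ : Type}

open Classical in
/-- The distribution of the value returned by a program, executed over the real numbers. -/
noncomputable def law : Prog ℝ α → PMF α
  | ret a => PMF.pure a
  | tick k => law k
  | lit q k => law (k (q : ℝ))
  | arith o x y k => law (k (o.eval x y))
  | sqrt x k => law (k (Real.sqrt x))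
  | less x y k => law (k (decide (x < y)))
  | sample p k => (draw p).bind fun i => law (k i)

open Classical in
/-- The number of steps of a program in the worst case over all random choices.  Every instruction
takes one step, except that drawing from a distribution on `n` points takes `n` steps. -/
noncomputable def cost : Prog ℝ α → ℕ
  | ret _ => 0
  | tick k => 1 + cost k
  | lit q k => 1 + cost (k (q : ℝ))
  | arith o x y k => 1 + cost (k (o.eval x y))
  | sqrt x k => 1 + cost (k (Real.sqrt x))
  | less x y k => 1 + cost (k (decide (x < y)))
  | @sample _ _ n _ _ k => n + Finset.univ.sup fun i => cost (k i)

/-! Single instructions as programs. -/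

def step : Prog R Unit := tick (ret ())
def const (q : ℚ) : Prog R R := lit q ret
def plus (x y : R) : Prog R R := arith .plus x y ret
def minus (x y : R) : Prog R R := arith .minus x y ret
def times (x y : R) : Prog R R := arith .times x y ret
def divide (x y : R) : Prog R R := arith .divide x y ret
def root (x : R) : Prog R R := sqrt x ret
def lt (x y : R) : Prog R Bool := less x y ret
def pick {n : ℕ} [NeZero n] (p : Fin n → R) : Prog R (Fin n) := sample p ret

/-- `for i = 0, …, m - 1 do s ← f i s`; every round takes one step besides those of its body. -/
def loop : (m : ℕ) → (Fin m → σ → Prog R σ) → σ → Prog R σ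
  | 0, _, s => ret s
  | m + 1, f, s => do
      let s ← loop m (fun i => f i.castSucc) s
      step
      f (Fin.last m) s

/-- Fill an array of length `m`; storing an entry takes one step besides those of computing it. -/
def tabulate : (m : ℕ) → (Fin m → Prog R β) → Prog R (Fin m → β)
  | 0, _ => ret Fin.elim0
  | m + 1, f => do
      let v ← tabulate m (fun i => f i.castSucc)
      let a ← f (Fin.last m)
      step
      ret (Fin.snoc (α := fun _ => β) v a)

/-! ### Linear algebra on the machine -/

/-- The inner product of two vectors. -/
def dot {m : ℕ} (u v : Fin m → R) : Prog R R := do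
  let z ← const 0
  loop m (fun i s => do
    let t ← times (u i) (v i)
    plus s t) z

/-- The vector `A w`. -/
def matVec {n d : ℕ} (A : Matrix (Fin n) (Fin d) R) (w : Fin d → R) : Prog R (Fin n → R) :=
  tabulate n fun i => dot (A i) w

/-- The vector `u + c v`. -/
def plusMul {m : ℕ} (u : Fin m → R) (c : R) (v : Fin m → R) : Prog R (Fin m → R) :=
  tabulate m fun i => do
    let t ← times c (v i)
    plus (u i) t

/-- The vector `u - c v`. -/
def minusMul {m : ℕ} (u : Fin m → R) (c : R) (v : Fin m → R) : Prog R (Fin m → R) :=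
  tabulate m fun i => do
    let t ← times c (v i)
    minus (u i) t

/-- The coefficient `⟨b, q⟩ / ⟨q, q⟩`, or `0` if `q = 0`. -/
def coef {m : ℕ} (b q : Fin m → R) : Prog R R := do
  let s ← dot q q
  let t ← dot b q
  let z ← const 0
  if ← lt z s then divide t s else ret z

/-- Gram–Schmidt orthogonalization (without normalization) of the vectors `B j`, where the vectors
`E j` undergo the same linear operations.  If `E` is the standard basis then in every
pair `(q, v)` of the result `q` is the combination of the `B j` with the coefficients `v j`. -/
def gramSchmidt {m D : ℕ} : (d : ℕ) → (Fin d → Fin m → R) → (Fin d → Fin D → R) →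
    Prog R (Fin d → (Fin m → R) × (Fin D → R))
  | 0, _, _ => ret Fin.elim0
  | d + 1, B, E => do
      let Q ← gramSchmidt d (fun j => B j.castSucc) (fun j => E j.castSucc)
      let b := B (Fin.last d)
      let qv ← loop d (fun k s => do
        let c ← coef b (Q k).1
        let q ← minusMul s.1 c (Q k).1
        let v ← minusMul s.2 c (Q k).2
        ret (q, v)) (b, E (Fin.last d))
      step
      ret (Fin.snoc (α := fun _ => (Fin m → R) × (Fin D → R)) Q qv)

/-- The columns of `A`, orthogonalized, together with their coefficients.  This is the
precomputation that makes the least squares problems for `A` cheap. -/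
def factorize {m d : ℕ} (A : Matrix (Fin m) (Fin d) R) :
    Prog R (Fin d → (Fin m → R) × (Fin d → R)) := do
  let E ← tabulate d fun i => tabulate d fun j => if i = j then const 1 else const 0
  let B ← tabulate d fun j => tabulate m fun i => ret (A i j)
  gramSchmidt d B E

/-- A minimizer `w` of `‖A w - b‖²`, from the factorization of `A`. -/
def regress {m d : ℕ} (Q : Fin d → (Fin m → R) × (Fin d → R)) (b : Fin m → R) :
    Prog R (Fin d → R) := do
  let w ← tabulate d fun _ => const 0
  loop d (fun k w => do
    let c ← coef b (Q k).1
    plusMul w c (Q k).2) w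

/-- The number `min_w ‖A w - x‖²`, from the factorization of `A`. -/
def spanDist {n d : ℕ} (A : Matrix (Fin n) (Fin d) R) (Q : Fin d → (Fin n → R) × (Fin d → R))
    (x : Fin n → R) : Prog R R := do
  let w ← regress Q x
  let y ← matVec A w
  let z ← tabulate n fun i => minus (y i) (x i)
  dot z z

/-- The normalized leverage scores, from the factorization of `A`: the matrix `U` with
columns `q_j / ‖q_j‖` is formed, and the squared norms of its rows are divided by `d`. -/
def leverage {n d : ℕ} (Q : Fin d → (Fin n → R) × (Fin d → R)) : Prog R (Fin n → R) := do
  let s ← tabulate d fun j => do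
    let t ← dot (Q j).1 (Q j).1
    root t
  let dd ← const d
  tabulate n fun i => do
    let u ← tabulate d fun j => divide ((Q j).1 i) (s j)
    let t ← dot u u
    divide t dd

/-! ### The attack -/

/-- The binary vector `x` on the sampled rows takes the values prescribed by `x'`, and elsewhere
it rounds `y` at `1/2`.  A row that was sampled several times gets the largest of its values. -/
def rounding {n r : ℕ} (idx : Fin r → Fin n) (x' : Fin r → R) (y : Fin n → R) :
    Prog R (Fin n → R) :=
  tabulate n fun i => do
    let found ← loop r (fun j (acc : Option R) =>
      if idx j = i then
        match acc with
        | none => ret (some (x' j))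
        | some v => do
            if ← lt v (x' j) then ret (some (x' j)) else ret (some v)
      else ret acc) none
    match found with
    | some v => ret v
    | none => do
        let h ← const (1 / 2)
        if ← lt (y i) h then const 0 else const 1

/-- The attack by linear regression: leverage score sampling of `r` rows of `A`, enumeration of
the nonzero binary vectors of length `r` (the binary digits of `1, …, 2 ^ r - 1`), regression and
rounding for each of them, and choice of the best candidate. -/
def attack {n d : ℕ} [NeZero n] (A : Matrix (Fin n) (Fin d) R) (r : ℕ) : Prog R (Fin n → R) := do
  let Q ← factorize A
  let p ← leverage Q
  let idx ← tabulate r fun _ => pick p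
  let rr ← const r
  let D ← tabulate r fun j => do
    let t ← times rr (p (idx j))
    let s ← root t
    let one ← const 1
    divide one s
  let A' ← tabulate r fun j => tabulate d fun k => times (D j) (A (idx j) k)
  let Q' ← factorize (Matrix.of A')
  let e ← tabulate n fun i => if i = 0 then const 1 else const 0
  let δ ← spanDist A Q e
  let best ← loop (2 ^ r - 1) (fun m (best : (Fin n → R) × R) => do
    let x' ← tabulate r fun j => if Nat.testBit (m + 1) j then const 1 else const 0
    let b ← tabulate r fun j => times (D j) (x' j)
    let w ← regress Q' b
    let y ← matVec A w
    let x ← rounding idx x' y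
    let δ ← spanDist A Q x
    if ← lt δ best.2 then ret (x, δ) else ret best) (e, δ)
  ret best.1

end Prog

/-! ### The problem and the algorithm in mathematical terms -/

/-- `‖u - v‖₂²`. -/
def sqDist {ι : Type*} [Fintype ι] (u v : ι → ℝ) : ℝ := ∑ i, (u i - v i) ^ 2

/-- `min_w ‖A w - x‖₂²`, the squared distance of `x` to the column span of `A`. -/
noncomputable def colDistSq {n d : ℕ} (A : Matrix (Fin n) (Fin d) ℝ) (x : Fin n → ℝ) : ℝ :=
  ⨅ w : Fin d → ℝ, sqDist (A.mulVec w) x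

/-- The set `{0,1}^m \ {0}`. -/
def nonzeroBinary (m : ℕ) : Set (Fin m → ℝ) := {x | ∀ i, x i = 0 ∨ x i = 1} \ {0}

/-- `A = U diag(s) Vᵀ` is a (thin) singular value decomposition; the columns of `U` are
left singular vectors of `A`. -/
structure IsThinSVD {n d : ℕ} (A U : Matrix (Fin n) (Fin d) ℝ) (s : Fin d → ℝ)
    (V : Matrix (Fin d) (Fin d) ℝ) : Prop where
  left_orthonormal : U.transpose * U = 1
  right_orthonormal : V.transpose * V = 1
  nonneg : ∀ j, 0 ≤ s j
  eq_mul : A = U * Matrix.diagonal s * V.transpose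

/-- `P` is the distribution of normalized leverage scores of `A`: `P i = ‖U_(i)‖² / d`, where `U`
is a matrix of left singular vectors of `A`. -/
def IsLeverageDist {n d : ℕ} (A : Matrix (Fin n) (Fin d) ℝ) (P : PMF (Fin n)) : Prop :=
  ∃ U s V, IsThinSVD A U s V ∧ ∀ i, (P i).toReal = (∑ j, U i j ^ 2) / d

/-- The distribution of `r` independent samples from `P`. -/
noncomputable def iidLaw {n : ℕ} (P : PMF (Fin n)) (r : ℕ) : PMF (Fin r → Fin n) :=
  PMF.ofFintype (fun idx => ∏ j, P (idx j)) (by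
    have h : ∑ i, P i = 1 := by rw [← tsum_fintype (L := .unconditional _)]; exact P.tsum_coe
    have := Finset.prod_univ_sum (fun _ : Fin r => (Finset.univ : Finset (Fin n)))
      (fun _ i => P i)
    simp only [h, Finset.prod_const_one, Fintype.piFinset_univ] at this
    exact this.symm)

/-- The sampling matrix `S`, whose `j`-th row selects the coordinate `idx j`. -/
def samplingMatrix {n r : ℕ} (idx : Fin r → Fin n) : Matrix (Fin r) (Fin n) ℝ :=
  Matrix.of fun j i => if idx j = i then 1 else 0

/-- The diagonal rescaling matrix `D` with entries `1 / √(r p_{i_j})`. -/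
noncomputable def rescalingMatrix {n r : ℕ} (P : PMF (Fin n)) (idx : Fin r → Fin n) :
    Matrix (Fin r) (Fin r) ℝ :=
  Matrix.diagonal fun j => 1 / Real.sqrt (r * (P (idx j)).toReal)

/-- `w` is a minimizer of `‖M w - b‖₂²`. -/
def IsLeastSquares {m d : ℕ} (M : Matrix (Fin m) (Fin d) ℝ) (b : Fin m → ℝ) (w : Fin d → ℝ) :
    Prop :=
  ∀ w', sqDist (M.mulVec w) b ≤ sqDist (M.mulVec w') b

/-- `x` is the vector formed from `x'` and `y = A w'`: on sampled rows `i = i_j` it has the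
value `x'_j`, and elsewhere it rounds `y i` at `1/2`.  When the same row was sampled for several `j`
with different `x'_j`, any of these values may be used as long as `x` does not become zero. -/
structure IsRounding {n r : ℕ} (idx : Fin r → Fin n) (x' : Fin r → ℝ) (y x : Fin n → ℝ) :
    Prop where
  sampled : ∀ i ∈ Set.range idx, ∃ j, idx j = i ∧ x i = x' j
  low : ∀ i ∉ Set.range idx, y i < 1 / 2 → x i = 0
  high : ∀ i ∉ Set.range idx, 1 / 2 ≤ y i → x i = 1
  ne_zero : x ≠ 0

/-- `xs` is a possible output of the search phase of the algorithm, when the sampled rows are `idx`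
and the sampling distribution is `P`.  Here `w x'` and `x x'` are the vectors computed in the round
of the loop that treats `x'`. -/
def IsSearchOutput {n d r : ℕ} [NeZero n] (A : Matrix (Fin n) (Fin d) ℝ) (P : PMF (Fin n))
    (idx : Fin r → Fin n) (xs : Fin n → ℝ) : Prop :=
  ∃ (w : (Fin r → ℝ) → Fin d → ℝ) (x : (Fin r → ℝ) → Fin n → ℝ),
    (∀ x' ∈ nonzeroBinary r,
      IsLeastSquares (rescalingMatrix P idx * samplingMatrix idx * A)
          ((rescalingMatrix P idx).mulVec x') (w x') ∧
        IsRounding idx x' (A.mulVec (w x')) (x x')) ∧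
    xs ∈ insert (Pi.single 0 1) (x '' nonzeroBinary r) ∧
    IsMinOn (colDistSq A) (insert (Pi.single 0 1) (x '' nonzeroBinary r)) xs

/-- `μ` is a distribution of the output of the algorithm on the input `A` with `r` samples: the rows
are independent samples from the leverage score distribution and the output is obtained from
the sampled rows by the search phase, with some way `out` of breaking ties. -/
def IsAttackLaw {n d : ℕ} [NeZero n] (A : Matrix (Fin n) (Fin d) ℝ) (r : ℕ)
    (μ : PMF (Fin n → ℝ)) : Prop :=
  ∃ P : PMF (Fin n), IsLeverageDist A P ∧ ∃ out : (Fin r → Fin n) → Fin n → ℝ,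
    (∀ idx, (∀ j, P (idx j) ≠ 0) → IsSearchOutput A P idx (out idx)) ∧
    μ = (iidLaw P r).map out

/-! Write `A = U N` with orthonormal columns in `U`, let `b` be an optimal binary vector and `e = b
- U Uᵀ b` its residual, so `dist²(b) = ‖e‖²`. Among the enumerated `x'` is the restriction of `b` to
the sampled rows. Let `w` solve that sampled regression and let `x` be the rounding of `A w`. On
sampled rows `x` agrees with `b`, elsewhere it is the binary vector nearest to `A w`, so `‖A w - x‖
≤ ‖A w - b‖` and it suffices that `‖A w - b‖² ≤ (1 + ε) ‖e‖²`
(`IsSearchOutput.colDistSq_le_of_regression`). If the restriction is zero, it is not enumerated; but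
then `w = 0` solves the regression, and the first unit vector, at squared distance at most `1 ≤
‖b‖²`, does the job.

By Pythagoras `‖A w - b‖² = ‖β‖² + ‖e‖²` with `β = N w - Uᵀ b`. The normal equations read `G β = Y`,
where `G = ∑ j, U_i U_iᵀ / p_i` and `Y = ∑ j, (e_i / p_i) U_i` over the samples `i = i_j`. Two
events, each failing with probability at most `1/6`, give `‖β‖² ≤ ε ‖e‖²`
(`sqDist_le_of_sampled_leastSquares`): `G ≥ r / 16`, and `‖Y‖² ≤ (r / 16)² ε ‖e‖²`. The second
follows from a variance computation and Markov's inequality, as `E Y = r Uᵀ e = 0`; it needs `r` of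
order `d / ε`.

The first needs only a constant-factor lower bound, hence `r` of order `d log d`. It is proved by a
potential argument: for `M = (r / 16) I + ∑ x xᵀ` the expected value of `tr M⁻ᵖ`, with `p` about
`log₂ (12 d)`, contracts with every sample (`sum_mul_trace_inv_pow_le`). The decrease under one
rank-one update is bounded in `Matrix.PosDef.trace_inv_add_vecMulVec_pow_le`, which rests on a
Chebyshev sum inequality.

For the running time, a Hoare-style calculus bounds values and steps together. Unnormalized
Gram–Schmidt serves both for regression, even when the sampled matrix loses rank, and for the
leverage scores, which depend only on the column space. Each of the `2 ^ r - 1` rounds costs `O(n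
r)`, and the precomputation is absorbed by `n r 2 ^ r`. -/

section PowerTrace

/-! ### Traces of powers under rank-one updates. -/

open Matrix

/-- A Chebyshev sum inequality: `h` need not be monotone in `l`, only where it is nonnegative. -/
theorem sum_mul_sum_le_of_single_crossing {ι : Type*} [Fintype ι] {ν l h : ι → ℝ}
    (hν : ∀ k, 0 ≤ ν k) (hl : ∀ k, 0 ≤ l k)
    (hh : ∀ k k', l k ≤ l k' → 0 ≤ h k → h k ≤ h k') (H : 0 ≤ ∑ k, ν k * h k) (i : ℕ) :
    (∑ k, ν k * h k) * (∑ k, ν k * l k ^ i) ≤ (∑ k, ν k * l k ^ i * h k) * ∑ k, ν k := by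
  set S := ∑ k, ν k with hS
  set T := ∑ k, ν k * h k with hT
  have hS0 : 0 ≤ S := Finset.sum_nonneg fun k _ => hν k
  rcases hS0.eq_or_lt with h0 | hpos
  · have hz : ∀ k, ν k = 0 := fun k =>
      (Finset.sum_eq_zero_iff_of_nonneg fun k _ => hν k).1 (hS.symm.trans h0.symm) k
        (Finset.mem_univ k)
    simp [hz]
  have hg0 : ∑ k, ν k * (S * h k - T) = 0 := by
    simp only [mul_sub, Finset.sum_sub_distrib]
    rw [← Finset.sum_mul, ← hS, hT, Finset.mul_sum, sub_eq_zero]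
    exact Finset.sum_congr rfl fun k _ => by ring
  -- The points where `h` is at least its mean `T / S ≥ 0` form an upper set for `l`, because `h` is
  -- monotone where it is nonnegative. So `l ^ i - t` and `S h - T` have the same sign when `t` is
  -- the least value of `l ^ i` on that set; if the set is empty, any upper bound of `l ^ i` serves.
  have hthr : ∃ t : ℝ, ∀ k, t * (S * h k - T) ≤ l k ^ i * (S * h k - T) := by
    by_cases hex : ∃ k, 0 ≤ S * h k - T
    · have hne : (Finset.univ.filter fun k => 0 ≤ S * h k - T).Nonempty := by
        obtain ⟨k, hk⟩ := hex
        exact ⟨k, by simpa using hk⟩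
      obtain ⟨k₀, hk₀, hmin⟩ := Finset.exists_min_image _ l hne
      simp only [Finset.mem_filter, Finset.mem_univ, true_and] at hk₀ hmin
      refine ⟨l k₀ ^ i, fun k => ?_⟩
      by_cases hk : 0 ≤ S * h k - T
      · exact mul_le_mul_of_nonneg_right (pow_le_pow_left₀ (hl _) (hmin k hk) i) hk
      · have hlt : l k ≤ l k₀ := by
          by_contra hcon
          push Not at hcon
          have h1 : 0 ≤ h k₀ := by
            by_contra hneg
            push Not at hneg
            nlinarith
          have h2 := hh k₀ k hcon.le h1
          exact hk (hk₀.trans (by nlinarith))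
        exact mul_le_mul_of_nonpos_right (pow_le_pow_left₀ (hl _) hlt i) (le_of_not_ge hk)
    · push Not at hex
      refine ⟨∑ k, l k ^ i, fun k => ?_⟩
      exact mul_le_mul_of_nonpos_right
        (Finset.single_le_sum (f := fun k => l k ^ i) (fun k _ => pow_nonneg (hl k) i)
          (Finset.mem_univ k)) (hex k).le
  obtain ⟨t, ht⟩ := hthr
  have h1 : t * ∑ k, ν k * (S * h k - T) ≤ ∑ k, ν k * l k ^ i * (S * h k - T) := by
    rw [Finset.mul_sum]
    refine Finset.sum_le_sum fun k _ => ?_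
    have := mul_le_mul_of_nonneg_left (ht k) (hν k)
    linarith
  rw [hg0, mul_zero] at h1
  have h2 : ∑ k, ν k * l k ^ i * (S * h k - T)
      = (∑ k, ν k * l k ^ i * h k) * S - T * ∑ k, ν k * l k ^ i := by
    rw [Finset.sum_mul, Finset.mul_sum, ← Finset.sum_sub_distrib]
    exact Finset.sum_congr rfl fun k _ => by ring
  linarith

/-- With `B = diag l` and `B' = B - c B x xᵀ B`, the vector `B'^m B x` is `x` multiplied
entrywise by `crossingWeight l x c m`. -/
def crossingWeight {ι : Type*} [Fintype ι] (l x : ι → ℝ) (c : ℝ) : ℕ → ι → ℝ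
  | 0 => l
  | m + 1 => fun k =>
      l k * (crossingWeight l x c m k - c * ∑ j, l j * x j ^ 2 * crossingWeight l x c m j)

/-- Monotonicity on the nonnegative part survives one step, since the step subtracts a nonnegative
constant and multiplies by `l`. That the constant is nonnegative is the moment bound with `i = 1`,
so both claims run in one induction. In the moment bound, the Chebyshev inequality shows that the
subtracted term is at most the fraction `c ∑ l x²` of the moment itself. -/
theorem crossingWeight_spec {ι : Type*} [Fintype ι] {l x : ι → ℝ} {c : ℝ}
    (hl : ∀ k, 0 < l k) (hc : 0 ≤ c) (hcs : c * ∑ k, l k * x k ^ 2 ≤ 1) (m : ℕ) :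
    (∀ k k', l k ≤ l k' → 0 ≤ crossingWeight l x c m k →
      crossingWeight l x c m k ≤ crossingWeight l x c m k') ∧
    ∀ i, (1 - c * ∑ k, l k * x k ^ 2) ^ m * ∑ k, l k ^ (m + i + 1) * x k ^ 2
      ≤ ∑ k, l k ^ i * x k ^ 2 * crossingWeight l x c m k := by
  induction m with
  | zero =>
    refine ⟨fun k k' h _ => h, fun i => le_of_eq ?_⟩
    simp only [pow_zero, one_mul, crossingWeight]
    exact Finset.sum_congr rfl fun k _ => by ring
  | succ m ih =>
    obtain ⟨ih1, ih2⟩ := ih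
    have hmom : ∀ a i, 0 ≤ (1 - c * ∑ k, l k * x k ^ 2) ^ a * ∑ k, l k ^ i * x k ^ 2 := fun a i =>
      mul_nonneg (pow_nonneg (by linarith) _)
        (Finset.sum_nonneg fun k _ => mul_nonneg (pow_nonneg (hl k).le _) (sq_nonneg _))
    have hκ : 0 ≤ ∑ j, l j * x j ^ 2 * crossingWeight l x c m j := by
      have := (hmom _ _).trans (ih2 1)
      simpa using this
    refine ⟨fun k k' hkk h => ?_, fun i => ?_⟩
    · simp only [crossingWeight] at h ⊢
      have h1 := nonneg_of_mul_nonneg_right h (hl k)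
      have h2 := ih1 k k' hkk (by nlinarith [mul_nonneg hc hκ])
      exact mul_le_mul hkk (by linarith) h1 (hl k').le
    · have hch := sum_mul_sum_le_of_single_crossing (ν := fun k => l k * x k ^ 2)
        (fun k => mul_nonneg (hl k).le (sq_nonneg _)) (fun k => (hl k).le) ih1 hκ i
      have e1 : ∑ k, l k ^ i * x k ^ 2 * crossingWeight l x c (m + 1) k
          = ∑ k, l k ^ (i + 1) * x k ^ 2 * crossingWeight l x c m k
            - c * ((∑ k, l k * x k ^ 2 * crossingWeight l x c m k)
              * ∑ k, l k * x k ^ 2 * l k ^ i) := by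
        rw [Finset.mul_sum, Finset.mul_sum, ← Finset.sum_sub_distrib]
        exact Finset.sum_congr rfl fun k _ => by simp only [crossingWeight]; ring
      have e2 : ∑ k, l k * x k ^ 2 * l k ^ i * crossingWeight l x c m k
          = ∑ k, l k ^ (i + 1) * x k ^ 2 * crossingWeight l x c m k :=
        Finset.sum_congr rfl fun k _ => by ring
      rw [e2] at hch
      have h3 := mul_le_mul_of_nonneg_left (ih2 (i + 1))
        (by linarith : 0 ≤ 1 - c * ∑ k, l k * x k ^ 2)
      have e3 : m + (i + 1) + 1 = m + 1 + i + 1 := by ring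
      rw [e3] at h3
      rw [e1, pow_succ', mul_assoc]
      refine h3.trans ?_
      nlinarith [mul_le_mul_of_nonneg_left hch hc]

/-- The factors `B'` are replaced by `B = diagonal l` one at a time. Each replacement changes the
trace by `c` times a moment of `crossingWeight`, which is bounded below by `crossingWeight_spec`;
the `p` replacements add up to the factor `p`. -/
theorem trace_pow_diagonal_sub_le {ι : Type*} [Fintype ι] [DecidableEq ι] {l x : ι → ℝ} {c : ℝ}
    (hl : ∀ k, 0 < l k) (hc : 0 ≤ c) (hcs : c * ∑ k, l k * x k ^ 2 ≤ 1) (p : ℕ) :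
    ((diagonal l - c • vecMulVec (l * x) (l * x)) ^ p).trace
      ≤ ∑ k, l k ^ p - c * p * (1 - c * ∑ k, l k * x k ^ 2) ^ p *
        ∑ k, l k ^ (p + 1) * x k ^ 2 := by
  set B' := diagonal l - c • vecMulVec (l * x) (l * x) with hB'
  set s := ∑ k, l k * x k ^ 2 with hs
  have hv : ∀ m, B' ^ m *ᵥ (l * x) = crossingWeight l x c m * x := by
    intro m
    induction m with
    | zero => simp [crossingWeight]
    | succ m ih =>
      rw [pow_succ', ← mulVec_mulVec, ih, hB', sub_mulVec, smul_mulVec, vecMulVec_mulVec]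
      ext k
      simp only [Pi.sub_apply, mulVec_diagonal, Pi.mul_apply, Pi.smul_apply, dotProduct,
        crossingWeight, MulOpposite.smul_eq_mul_unop, MulOpposite.unop_op, smul_eq_mul]
      have : ∑ j, l j * x j * (crossingWeight l x c m j * x j)
          = ∑ j, l j * x j ^ 2 * crossingWeight l x c m j :=
        Finset.sum_congr rfl fun k _ => by ring
      rw [this]
      ring
  have hs0 : 0 ≤ s := Finset.sum_nonneg fun k _ => mul_nonneg (hl k).le (sq_nonneg _)
  have key : ∀ m i : ℕ, (B' ^ m * diagonal l ^ i).trace ≤ ∑ k, l k ^ (m + i)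
      - c * m * ((1 - c * s) ^ (m + i) * ∑ k, l k ^ (m + i + 1) * x k ^ 2) := by
    intro m
    induction m with
    | zero => intro i; simp [diagonal_pow, trace_diagonal]
    | succ m ih =>
      intro i
      have h1 : B' ^ (m + 1) * diagonal l ^ i
          = B' ^ m * diagonal l ^ (i + 1)
            - c • vecMulVec (B' ^ m *ᵥ (l * x)) ((l * x) ᵥ* diagonal l ^ i) := by
        rw [pow_succ, mul_assoc]
        nth_rewrite 2 [hB']
        rw [sub_mul, mul_sub, ← pow_succ', smul_mul_assoc, mul_smul_comm, vecMulVec_mul,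
          mul_vecMulVec]
      have h2 := (crossingWeight_spec hl hc hcs m).2 (i + 1)
      have h3 : (B' ^ m *ᵥ (l * x)) ⬝ᵥ ((l * x) ᵥ* diagonal l ^ i)
          = ∑ k, l k ^ (i + 1) * x k ^ 2 * crossingWeight l x c m k := by
        rw [hv, diagonal_pow]
        simp only [dotProduct, vecMul_diagonal, Pi.mul_apply, Pi.pow_apply]
        exact Finset.sum_congr rfl fun k _ => by ring
      rw [h1, trace_sub, trace_smul, trace_vecMulVec, h3, smul_eq_mul]
      have h4 := ih (i + 1)
      rw [← hs] at h2
      have e : m + (i + 1) = m + 1 + i := by ring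
      rw [e] at h4 h2
      have hM : 0 ≤ ∑ k, l k ^ (m + 1 + i + 1) * x k ^ 2 :=
        Finset.sum_nonneg fun k _ => mul_nonneg (pow_nonneg (hl k).le _) (sq_nonneg _)
      have h5 : (1 - c * s) ^ (m + 1 + i) * ∑ k, l k ^ (m + 1 + i + 1) * x k ^ 2
          ≤ (1 - c * s) ^ m * ∑ k, l k ^ (m + 1 + i + 1) * x k ^ 2 := by
        refine mul_le_mul_of_nonneg_right ?_ hM
        exact pow_le_pow_of_le_one (by linarith) (by nlinarith) (by omega)
      have h6 := mul_le_mul_of_nonneg_left (h5.trans h2) hc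
      push_cast
      linarith
  have := key p 0
  simpa [mul_assoc] using this

/-- The spectral theorem for real positive definite matrices. -/
theorem Matrix.PosDef.exists_orthogonal_diagonal {ι : Type*} [Fintype ι] [DecidableEq ι]
    {B : Matrix ι ι ℝ} (hB : B.PosDef) :
    ∃ (O : Matrix ι ι ℝ) (l : ι → ℝ), Oᵀ * O = 1 ∧ O * Oᵀ = 1 ∧ (∀ k, 0 < l k) ∧
      B = O * diagonal l * Oᵀ := by
  refine ⟨hB.1.eigenvectorUnitary, hB.1.eigenvalues, ?_, ?_, hB.eigenvalues_pos, ?_⟩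
  · have := Unitary.coe_star_mul_self hB.1.eigenvectorUnitary
    rwa [star_eq_conjTranspose, conjTranspose_eq_transpose_of_trivial] at this
  · have := Unitary.coe_mul_star_self hB.1.eigenvectorUnitary
    rwa [Unitary.coe_star, star_eq_conjTranspose,
      conjTranspose_eq_transpose_of_trivial] at this
  · have := hB.1.spectral_theorem
    rw [Unitary.conjStarAlgAut_apply, star_eq_conjTranspose,
      conjTranspose_eq_transpose_of_trivial] at this
    simpa [Function.comp_def] using this

theorem Matrix.orthogonal_conj_pow {ι : Type*} [Fintype ι] [DecidableEq ι] {O : Matrix ι ι ℝ}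
    (hO : Oᵀ * O = 1) (hO' : O * Oᵀ = 1) (M : Matrix ι ι ℝ) (p : ℕ) :
    (O * M * Oᵀ) ^ p = O * M ^ p * Oᵀ := by
  induction p with
  | zero => simp [hO']
  | succ p ih =>
    rw [pow_succ, ih, pow_succ]
    calc O * M ^ p * Oᵀ * (O * M * Oᵀ) = O * M ^ p * (Oᵀ * O) * M * Oᵀ := by
          simp only [mul_assoc]
      _ = _ := by rw [hO]; simp only [mul_one, mul_assoc]

theorem Matrix.orthogonal_conj_trace {ι : Type*} [Fintype ι] [DecidableEq ι] {O : Matrix ι ι ℝ}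
    (hO : Oᵀ * O = 1) (M : Matrix ι ι ℝ) : (O * M * Oᵀ).trace = M.trace := by
  rw [trace_mul_comm, ← mul_assoc, hO, one_mul]

theorem Matrix.PosDef.trace_pow_sub_le {ι : Type*} [Fintype ι] [DecidableEq ι]
    {B : Matrix ι ι ℝ} (hB : B.PosDef) {x : ι → ℝ} {c : ℝ} (hc : 0 ≤ c)
    (hcs : c * (x ⬝ᵥ B *ᵥ x) ≤ 1) (p : ℕ) :
    ((B - c • vecMulVec (B *ᵥ x) (B *ᵥ x)) ^ p).trace
      ≤ (B ^ p).trace - c * p * (1 - c * (x ⬝ᵥ B *ᵥ x)) ^ p * (x ⬝ᵥ B ^ (p + 1) *ᵥ x) := by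
  obtain ⟨O, l, hO, hO', hl, rfl⟩ := hB.exists_orthogonal_diagonal
  have hq : ∀ i, x ⬝ᵥ (O * diagonal l * Oᵀ) ^ i *ᵥ x = ∑ k, l k ^ i * (Oᵀ *ᵥ x) k ^ 2 := by
    intro i
    rw [orthogonal_conj_pow hO hO', ← mulVec_mulVec, ← mulVec_mulVec, dotProduct_mulVec,
      ← mulVec_transpose, diagonal_pow]
    simp only [dotProduct, mulVec_diagonal, Pi.pow_apply]
    exact Finset.sum_congr rfl fun k _ => by ring
  have hq1 := hq 1
  simp only [pow_one] at hq1
  rw [hq1] at hcs ⊢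
  have h := trace_pow_diagonal_sub_le hl hc hcs p
  have e1 : O * diagonal l * Oᵀ - c • vecMulVec ((O * diagonal l * Oᵀ) *ᵥ x)
      ((O * diagonal l * Oᵀ) *ᵥ x)
      = O * (diagonal l - c • vecMulVec (l * (Oᵀ *ᵥ x)) (l * (Oᵀ *ᵥ x))) * Oᵀ := by
    have e2 : (O * diagonal l * Oᵀ) *ᵥ x = O *ᵥ (l * (Oᵀ *ᵥ x)) := by
      rw [← mulVec_mulVec, ← mulVec_mulVec]
      congr 1
      ext k
      simp [mulVec_diagonal]
    rw [e2, mul_sub, sub_mul, mul_smul_comm, smul_mul_assoc, mul_vecMulVec, vecMulVec_mul,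
      vecMul_transpose]
  rw [e1, orthogonal_conj_pow hO hO', orthogonal_conj_trace hO, hq, orthogonal_conj_pow hO hO',
    orthogonal_conj_trace hO, diagonal_pow, trace_diagonal]
  simpa using h

/-- The inverse of a rank-one perturbation. -/
theorem Matrix.inv_add_vecMulVec_self {ι : Type*} [Fintype ι] [DecidableEq ι]
    {A : Matrix ι ι ℝ} (hA : A.PosDef) (x : ι → ℝ) :
    (A + vecMulVec x x)⁻¹ = A⁻¹ - (1 + x ⬝ᵥ A⁻¹ *ᵥ x)⁻¹ •
      vecMulVec (A⁻¹ *ᵥ x) (A⁻¹ *ᵥ x) := by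
  have hdet : IsUnit A.det := hA.det_pos.ne'.isUnit
  have hs : 0 ≤ x ⬝ᵥ A⁻¹ *ᵥ x := by
    simpa using hA.inv.posSemidef.dotProduct_mulVec_nonneg x
  have hsym : A⁻¹ᵀ = A⁻¹ := by
    have := hA.inv.1
    rwa [IsHermitian, conjTranspose_eq_transpose_of_trivial] at this
  refine inv_eq_right_inv ?_
  have h1 : vecMulVec x x * A⁻¹ = vecMulVec x (A⁻¹ *ᵥ x) := by
    rw [vecMulVec_mul, ← mulVec_transpose, hsym]
  rw [add_mul, mul_sub, mul_sub, mul_nonsing_inv _ hdet, h1, mul_smul_comm, mul_smul_comm,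
    mul_vecMulVec, mulVec_mulVec, mul_nonsing_inv _ hdet, one_mulVec, vecMulVec_mul_vecMulVec]
  set s := x ⬝ᵥ A⁻¹ *ᵥ x
  have h2 : vecMulVec x (s • A⁻¹ *ᵥ x) = s • vecMulVec x (A⁻¹ *ᵥ x) := vecMulVec_smul _ _ _
  rw [h2]
  ext i j
  simp only [Matrix.add_apply, Matrix.sub_apply, Matrix.smul_apply, smul_eq_mul]
  have : 1 + s ≠ 0 := by positivity
  field_simp
  ring

/-- By Sherman–Morrison the update of `A⁻¹` has `c = 1 / (1 + s)` with `s = xᵀ A⁻¹ x`, so that `1 -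
c s = c` and the loss carries the factor `(1 + s)^{-(p + 1)}`. Bernoulli's inequality bounds this
factor below by `1 - (p + 1) s`. -/
theorem Matrix.PosDef.trace_inv_add_vecMulVec_pow_le {ι : Type*} [Fintype ι] [DecidableEq ι]
    {A : Matrix ι ι ℝ} (hA : A.PosDef) (x : ι → ℝ) (p : ℕ) :
    ((A + vecMulVec x x)⁻¹ ^ p).trace ≤ (A⁻¹ ^ p).trace
      - p * (1 - (p + 1) * (x ⬝ᵥ A⁻¹ *ᵥ x)) * (x ⬝ᵥ A⁻¹ ^ (p + 1) *ᵥ x) := by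
  have hs : 0 ≤ x ⬝ᵥ A⁻¹ *ᵥ x := by
    simpa using hA.inv.posSemidef.dotProduct_mulVec_nonneg x
  have hq : 0 ≤ x ⬝ᵥ A⁻¹ ^ (p + 1) *ᵥ x := by
    simpa using (hA.inv.posSemidef.pow (p + 1)).dotProduct_mulVec_nonneg x
  rw [inv_add_vecMulVec_self hA]
  set s := x ⬝ᵥ A⁻¹ *ᵥ x with hsdef
  have hs1 : 0 < 1 + s := by linarith
  have hcs : (1 + s)⁻¹ * s ≤ 1 := by
    rw [inv_mul_le_iff₀ hs1]; linarith
  have h := hA.inv.trace_pow_sub_le (inv_nonneg.2 hs1.le) hcs p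
  rw [← hsdef] at h
  have e : 1 - (1 + s)⁻¹ * s = (1 + s)⁻¹ := by field_simp; ring
  rw [e] at h
  refine h.trans (sub_le_sub_left (mul_le_mul_of_nonneg_right ?_ hq) _)
  have hb : 1 - (p + 1) * s ≤ (1 + s)⁻¹ ^ (p + 1) := by
    have h1 : 1 - s ≤ (1 + s)⁻¹ := by
      rw [← e]
      nlinarith [inv_nonneg.2 hs1.le, inv_mul_cancel₀ hs1.ne', inv_le_one_of_one_le₀
        (by linarith : 1 ≤ 1 + s)]
    have h2 := one_add_mul_le_pow (a := (1 + s)⁻¹ - 1)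
      (by have := inv_nonneg.2 hs1.le; linarith) (p + 1)
    push_cast at h2
    rw [add_sub_cancel] at h2
    refine le_trans ?_ h2
    nlinarith [(Nat.cast_nonneg p : (0 : ℝ) ≤ p)]
  calc (p : ℝ) * (1 - (p + 1) * s) ≤ p * (1 + s)⁻¹ ^ (p + 1) :=
        mul_le_mul_of_nonneg_left hb (Nat.cast_nonneg p)
    _ = _ := by ring

end PowerTrace

/-! ### Expectations over independent samples. -/

section IidSums

/-- An expectation over `k + 1` independent samples, conditioned on the first `k` of them. -/
theorem sum_prod_mul_snoc {ι : Type*} [Fintype ι] [DecidableEq ι] (q : ι → ℝ) (k : ℕ)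
    (F : (Fin (k + 1) → ι) → ℝ) :
    ∑ idx : Fin (k + 1) → ι, (∏ j, q (idx j)) * F idx
      = ∑ idx : Fin k → ι, (∏ j, q (idx j)) *
        ∑ i, q i * F (Fin.snoc (α := fun _ => ι) idx i) := by
  rw [← (Fin.snocEquiv fun _ : Fin (k + 1) => ι).sum_comp, Fintype.sum_prod_type_right]
  refine Finset.sum_congr rfl fun idx _ => ?_
  rw [Finset.mul_sum]
  refine Finset.sum_congr rfl fun i _ => ?_
  simp only [Fin.snocEquiv_apply, Fin.prod_univ_castSucc, Fin.snoc_castSucc, Fin.snoc_last]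
  change _ * F (Fin.snoc idx i) = _
  ring

theorem sum_prod_eq_one {ι : Type*} [Fintype ι] [DecidableEq ι] {q : ι → ℝ} (hq : ∑ i, q i = 1)
    (k : ℕ) : ∑ idx : Fin k → ι, ∏ j, q (idx j) = 1 := by
  have := (Finset.prod_univ_sum (fun _ : Fin k => (Finset.univ : Finset ι)) fun _ i => q i).symm
  simpa [hq, Fintype.piFinset_univ] using this

open Matrix in
/-- The second moment of a sum of independent centred vectors. -/
theorem sum_prod_mul_norm_sq {ι κ : Type*} [Fintype ι] [DecidableEq ι] [Fintype κ] {q : ι → ℝ}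
    (hq : ∑ i, q i = 1) {y : ι → κ → ℝ} (hy : ∑ i, q i • y i = 0) (k : ℕ) :
    ∑ idx : Fin k → ι, (∏ j, q (idx j)) * ((∑ j, y (idx j)) ⬝ᵥ ∑ j, y (idx j))
      = k * ∑ i, q i * (y i ⬝ᵥ y i) := by
  induction k with
  | zero => simp
  | succ k ih =>
    rw [sum_prod_mul_snoc]
    have h : ∀ idx : Fin k → ι, ∑ i, q i *
        ((∑ j, y (Fin.snoc (α := fun _ => ι) idx i j)) ⬝ᵥ
          ∑ j, y (Fin.snoc (α := fun _ => ι) idx i j))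
        = ((∑ j, y (idx j)) ⬝ᵥ ∑ j, y (idx j)) + ∑ i, q i * (y i ⬝ᵥ y i) := by
      intro idx
      simp only [Fin.sum_univ_castSucc, Fin.snoc_castSucc, Fin.snoc_last]
      set Y := ∑ j, y (idx j)
      have h1 : ∀ i, q i * ((Y + y i) ⬝ᵥ (Y + y i))
          = q i * (Y ⬝ᵥ Y) + 2 * (Y ⬝ᵥ q i • y i) + q i * (y i ⬝ᵥ y i) := by
        intro i
        rw [add_dotProduct, dotProduct_add, dotProduct_add, dotProduct_smul, smul_eq_mul,
          dotProduct_comm (y i) Y]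
        ring
      simp only [h1, Finset.sum_add_distrib]
      rw [← Finset.sum_mul, hq, ← Finset.mul_sum, ← dotProduct_sum, hy]
      simp
    simp only [h, mul_add, Finset.sum_add_distrib]
    rw [ih, ← Finset.sum_mul, sum_prod_eq_one hq]
    push_cast
    ring

end IidSums

/-! ### Lower tail of a random Gram matrix. -/

section LowerTail

open Matrix

/-- Holds eigenvalue by eigenvalue, according as `l ≥ t` or `l ≤ t`. It makes the expected decrease
of the potential linear in the potential, so that expectations can be iterated. -/
theorem Matrix.PosDef.trace_pow_succ_ge {ι : Type*} [Fintype ι] [DecidableEq ι]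
    {B : Matrix ι ι ℝ} (hB : B.PosDef) {t : ℝ} (ht : 0 ≤ t) (p : ℕ) :
    t * (B ^ p).trace - Fintype.card ι * t ^ (p + 1) ≤ (B ^ (p + 1)).trace := by
  obtain ⟨O, l, hO, hO', hl, rfl⟩ := hB.exists_orthogonal_diagonal
  rw [orthogonal_conj_pow hO hO', orthogonal_conj_pow hO hO', orthogonal_conj_trace hO,
    orthogonal_conj_trace hO, diagonal_pow, diagonal_pow, trace_diagonal, trace_diagonal,
    ← nsmul_eq_mul, ← Finset.card_univ, ← Finset.sum_const, Finset.mul_sum,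
    ← Finset.sum_sub_distrib]
  refine Finset.sum_le_sum fun k _ => ?_
  simp only [Pi.pow_apply]
  rcases le_total t (l k) with h | h
  · have h1 : t * l k ^ p ≤ l k ^ (p + 1) := by
      rw [pow_succ']
      exact mul_le_mul_of_nonneg_right h (pow_nonneg (hl k).le _)
    have h2 := pow_nonneg ht (p + 1)
    linarith
  · have h1 : t * l k ^ p ≤ t ^ (p + 1) := by
      rw [pow_succ']
      exact mul_le_mul_of_nonneg_left (pow_le_pow_left₀ (hl k).le h p) ht
    have h2 := pow_nonneg (hl k).le (p + 1)
    linarith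

/-- Every eigenvalue of `A⁻¹ ^ p` is at most the trace, so a small potential keeps all eigenvalues
of `A` away from zero. -/
theorem Matrix.PosDef.le_of_trace_inv_pow_le {ι : Type*} [Fintype ι] [DecidableEq ι]
    {A : Matrix ι ι ℝ} (hA : A.PosDef) {b : ℝ} (hb : 0 < b) {p : ℕ} (hp : p ≠ 0)
    (h : (A⁻¹ ^ p).trace ≤ b⁻¹ ^ p) (v : ι → ℝ) : b * (v ⬝ᵥ v) ≤ v ⬝ᵥ A *ᵥ v := by
  obtain ⟨O, l, hO, hO', hl, rfl⟩ := hA.exists_orthogonal_diagonal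
  have hinv : (O * diagonal l * Oᵀ)⁻¹ = O * diagonal l⁻¹ * Oᵀ := by
    refine inv_eq_right_inv ?_
    calc O * diagonal l * Oᵀ * (O * diagonal l⁻¹ * Oᵀ)
        = O * (diagonal l * ((Oᵀ * O) * diagonal l⁻¹)) * Oᵀ := by simp only [mul_assoc]
      _ = O * Oᵀ := by
        rw [hO, one_mul, diagonal_mul_diagonal]
        have : (fun i => l i * l⁻¹ i) = fun _ => (1 : ℝ) := by
          ext i
          exact mul_inv_cancel₀ (hl i).ne'
        rw [this, diagonal_one, mul_one]
      _ = 1 := hO'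
  rw [hinv, orthogonal_conj_pow hO hO', orthogonal_conj_trace hO, diagonal_pow,
    trace_diagonal] at h
  have hlb : ∀ k, b ≤ l k := by
    intro k
    have h1 : (l k)⁻¹ ^ p ≤ b⁻¹ ^ p := le_trans
      (Finset.single_le_sum (f := fun k => (l⁻¹ ^ p) k)
        (fun k _ => pow_nonneg (inv_nonneg.2 (hl k).le) p) (Finset.mem_univ k)) h
    have h2 := le_of_pow_le_pow_left₀ hp (inv_nonneg.2 hb.le) h1
    exact (inv_le_inv₀ (hl k) hb).1 h2
  have e1 : v ⬝ᵥ v = ∑ k, (Oᵀ *ᵥ v) k ^ 2 := by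
    calc v ⬝ᵥ v = v ⬝ᵥ (O * Oᵀ) *ᵥ v := by rw [hO', one_mulVec]
      _ = (Oᵀ *ᵥ v) ⬝ᵥ (Oᵀ *ᵥ v) := by
        rw [← mulVec_mulVec, dotProduct_mulVec, ← mulVec_transpose]
      _ = _ := by simp only [dotProduct, sq]
  have e2 : v ⬝ᵥ (O * diagonal l * Oᵀ) *ᵥ v = ∑ k, l k * (Oᵀ *ᵥ v) k ^ 2 := by
    rw [← mulVec_mulVec, ← mulVec_mulVec, dotProduct_mulVec, ← mulVec_transpose]
    simp only [dotProduct, mulVec_diagonal]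
    exact Finset.sum_congr rfl fun k _ => by ring
  rw [e1, e2, Finset.mul_sum]
  exact Finset.sum_le_sum fun k _ => mul_le_mul_of_nonneg_right (hlb k) (sq_nonneg _)

/-- The matrix `a I + ∑ j, x_{i_j} x_{i_j}ᵀ`. -/
noncomputable def ridgeGram {ι κ : Type*} [DecidableEq κ] (a : ℝ) (x : ι → κ → ℝ) {k : ℕ}
    (idx : Fin k → ι) : Matrix κ κ ℝ :=
  a • (1 : Matrix κ κ ℝ) + ∑ j, vecMulVec (x (idx j)) (x (idx j))

theorem dotProduct_ridgeGram_mulVec {ι κ : Type*} [Fintype κ] [DecidableEq κ] (a : ℝ)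
    (x : ι → κ → ℝ) {k : ℕ} (idx : Fin k → ι)
    (v : κ → ℝ) :
    v ⬝ᵥ ridgeGram a x idx *ᵥ v = a * (v ⬝ᵥ v) + ∑ j, (x (idx j) ⬝ᵥ v) ^ 2 := by
  rw [ridgeGram, add_mulVec, smul_mulVec, one_mulVec, dotProduct_add, dotProduct_smul,
    smul_eq_mul, sum_mulVec, dotProduct_sum]
  congr 1
  refine Finset.sum_congr rfl fun j _ => ?_
  rw [vecMulVec_mulVec, dotProduct_smul, dotProduct_comm v, MulOpposite.smul_eq_mul_unop,
    MulOpposite.unop_op, sq]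

theorem ridgeGram_posDef {ι κ : Type*} [Fintype κ] [DecidableEq κ] {a : ℝ} (ha : 0 < a)
    (x : ι → κ → ℝ) {k : ℕ} (idx : Fin k → ι) :
    (ridgeGram a x idx).PosDef := by
  refine PosDef.of_dotProduct_mulVec_pos ?_ fun v hv => ?_
  · rw [IsHermitian, conjTranspose_eq_transpose_of_trivial, ridgeGram, transpose_add,
      transpose_smul, transpose_one, transpose_sum]
    simp only [transpose_vecMulVec]
  · rw [star_trivial, dotProduct_ridgeGram_mulVec]
    have h1 : 0 < v ⬝ᵥ v := by
      rw [← star_trivial v]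
      exact dotProduct_star_self_pos_iff.2 (by simpa using hv)
    have h2 : 0 ≤ ∑ j, (x (idx j) ⬝ᵥ v) ^ 2 := Finset.sum_nonneg fun _ _ => sq_nonneg _
    nlinarith [mul_pos ha h1]

/-- The ridge term makes every new sample a small perturbation, whatever the previous ones are; this
supplies the smallness condition of the one-step estimate. -/
theorem dotProduct_ridgeGram_inv_le {ι κ : Type*} [Fintype κ] [DecidableEq κ] {a : ℝ} (ha : 0 < a)
    (x : ι → κ → ℝ) {k : ℕ}
    (idx : Fin k → ι) (y : κ → ℝ) :
    y ⬝ᵥ (ridgeGram a x idx)⁻¹ *ᵥ y ≤ (y ⬝ᵥ y) / a := by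
  have hpd := ridgeGram_posDef ha x idx
  set z := (ridgeGram a x idx)⁻¹ *ᵥ y with hz
  have hy : ridgeGram a x idx *ᵥ z = y := by
    rw [hz, mulVec_mulVec, mul_nonsing_inv _ hpd.det_pos.ne'.isUnit, one_mulVec]
  have h1 : a * (z ⬝ᵥ z) ≤ y ⬝ᵥ z := by
    have h2 : 0 ≤ ∑ j, (x (idx j) ⬝ᵥ z) ^ 2 := Finset.sum_nonneg fun _ _ => sq_nonneg _
    have h3 := dotProduct_ridgeGram_mulVec a x idx z
    rw [hy, dotProduct_comm z y] at h3
    linarith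
  have h2 : 2 * (y ⬝ᵥ z) ≤ (y ⬝ᵥ y) / a + a * (z ⬝ᵥ z) := by
    have h3 : 0 ≤ ((y - a • z) ⬝ᵥ (y - a • z)) / a :=
      div_nonneg (by simpa using dotProduct_star_self_nonneg (y - a • z)) ha.le
    rw [sub_dotProduct, dotProduct_sub, dotProduct_sub, smul_dotProduct, dotProduct_smul,
      smul_dotProduct, dotProduct_smul, dotProduct_comm z y] at h3
    simp only [smul_eq_mul] at h3
    have h4 : (y ⬝ᵥ y - a * (y ⬝ᵥ z) - (a * (y ⬝ᵥ z) - a * (a * (z ⬝ᵥ z)))) / a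
        = (y ⬝ᵥ y) / a + a * (z ⬝ᵥ z) - 2 * (y ⬝ᵥ z) := by
      field_simp
      ring
    linarith
  linarith

/-- By isotropy the quadratic form `xᵀ A⁻¹ ^ (p + 1) x` has expectation `tr A⁻¹ ^ (p + 1)`, and at
least half of the decrease `p xᵀ A⁻¹ ^ (p + 1) x` survives because `(p + 1) xᵀ A⁻¹ x ≤ 1 / 2`. -/
theorem sum_mul_trace_inv_pow_le {ι κ : Type*} [Fintype ι] [Fintype κ] [DecidableEq κ] {q : ι → ℝ}
    {x : ι → κ → ℝ} (hq0 : ∀ i, 0 ≤ q i)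
    (hq1 : ∑ i, q i = 1) (hiso : ∑ i, q i • vecMulVec (x i) (x i) = 1)
    {A : Matrix κ κ ℝ} (hA : A.PosDef) {p : ℕ}
    (hx : ∀ i, (p + 1) * (x i ⬝ᵥ A⁻¹ *ᵥ x i) ≤ 1 / 2) {t : ℝ} (ht : 0 ≤ t) :
    ∑ i, q i * ((A + vecMulVec (x i) (x i))⁻¹ ^ p).trace
      ≤ (1 - p / 2 * t) * (A⁻¹ ^ p).trace + p / 2 * (Fintype.card κ * t ^ (p + 1)) := by
  have h1 : ∀ i, q i * ((A + vecMulVec (x i) (x i))⁻¹ ^ p).trace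
      ≤ q i * (A⁻¹ ^ p).trace - p / 2 * (q i * (x i ⬝ᵥ A⁻¹ ^ (p + 1) *ᵥ x i)) := by
    intro i
    have hQ : 0 ≤ x i ⬝ᵥ A⁻¹ ^ (p + 1) *ᵥ x i := by
      simpa using (hA.inv.posSemidef.pow (p + 1)).dotProduct_mulVec_nonneg (x i)
    have h := hA.trace_inv_add_vecMulVec_pow_le (x i) p
    have h2 : (p : ℝ) / 2 * (x i ⬝ᵥ A⁻¹ ^ (p + 1) *ᵥ x i) ≤
        p * (1 - (p + 1) * (x i ⬝ᵥ A⁻¹ *ᵥ x i)) * (x i ⬝ᵥ A⁻¹ ^ (p + 1) *ᵥ x i) := by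
      refine mul_le_mul_of_nonneg_right ?_ hQ
      have : (0 : ℝ) ≤ p := Nat.cast_nonneg p
      nlinarith [hx i]
    have h3 := mul_le_mul_of_nonneg_left (h.trans (sub_le_sub_left h2 _)) (hq0 i)
    linarith
  have h2 : ∑ i, q i * (x i ⬝ᵥ A⁻¹ ^ (p + 1) *ᵥ x i) = (A⁻¹ ^ (p + 1)).trace := by
    have h3 : (A⁻¹ ^ (p + 1) * ∑ i, q i • vecMulVec (x i) (x i)).trace
        = (A⁻¹ ^ (p + 1)).trace := by rw [hiso, mul_one]
    rw [← h3, Finset.mul_sum, trace_sum]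
    refine Finset.sum_congr rfl fun i _ => ?_
    rw [mul_smul_comm, mul_vecMulVec, trace_smul, trace_vecMulVec, smul_eq_mul,
      dotProduct_comm]
  refine (Finset.sum_le_sum fun i _ => h1 i).trans ?_
  rw [Finset.sum_sub_distrib, ← Finset.sum_mul, hq1, ← Finset.mul_sum, h2]
  have h4 := hA.inv.trace_pow_succ_ge ht p
  have h5 := mul_le_mul_of_nonneg_left h4 (by positivity : (0 : ℝ) ≤ p / 2)
  linarith

theorem ridgeGram_snoc {ι κ : Type*} [DecidableEq κ] (a : ℝ) (x : ι → κ → ℝ) {k : ℕ}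
    (idx : Fin k → ι) (i : ι) :
    ridgeGram a x (Fin.snoc (α := fun _ => ι) idx i)
      = ridgeGram a x idx + vecMulVec (x i) (x i) := by
  simp only [ridgeGram, Fin.sum_univ_castSucc, Fin.snoc_castSucc, Fin.snoc_last, add_assoc]

/-- The affine recursion given by the one-step estimate has fixed point `card κ * t ^ p` and
contraction factor `1 - p t / 2`; the other term is the decaying contribution of the initial matrix
`a I`. -/
theorem sum_prod_mul_trace_ridgeGram_inv_pow_le {ι κ : Type*} [Fintype ι] [DecidableEq ι]
    [Fintype κ]
    [DecidableEq κ] {q : ι → ℝ} {x : ι → κ → ℝ}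
    (hq0 : ∀ i, 0 ≤ q i) (hq1 : ∑ i, q i = 1) (hiso : ∑ i, q i • vecMulVec (x i) (x i) = 1)
    {L a t : ℝ} (hx : ∀ i, x i ⬝ᵥ x i ≤ L) {p : ℕ} (ha : 0 < a) (hap : 2 * (p + 1) * L ≤ a)
    (ht : 0 ≤ t) (hpt : p / 2 * t ≤ 1) (k : ℕ) :
    ∑ idx : Fin k → ι, (∏ j, q (idx j)) * ((ridgeGram a x idx)⁻¹ ^ p).trace
      ≤ Fintype.card κ * t ^ p + (1 - p / 2 * t) ^ k * (Fintype.card κ * a⁻¹ ^ p) := by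
  induction k with
  | zero =>
    have h1 : (a • (1 : Matrix κ κ ℝ))⁻¹ = a⁻¹ • 1 := by
      refine inv_eq_right_inv ?_
      rw [smul_mul_smul_comm, mul_inv_cancel₀ ha.ne', one_smul, mul_one]
    have : (0 : ℝ) ≤ Fintype.card κ * t ^ p := by positivity
    simp only [ridgeGram, Finset.univ_eq_empty, Finset.prod_empty, Finset.sum_empty, add_zero,
      one_mul, Finset.univ_unique, Finset.sum_singleton, pow_zero, h1, smul_pow, one_pow,
      trace_smul, trace_one, smul_eq_mul]
    linarith
  | succ k ih =>
    rw [sum_prod_mul_snoc]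
    have hstep : ∀ idx : Fin k → ι,
        ∑ i, q i * ((ridgeGram a x (Fin.snoc (α := fun _ => ι) idx i))⁻¹ ^ p).trace
          ≤ (1 - p / 2 * t) * ((ridgeGram a x idx)⁻¹ ^ p).trace
            + p / 2 * (Fintype.card κ * t ^ (p + 1)) := by
      intro idx
      simp only [ridgeGram_snoc]
      refine sum_mul_trace_inv_pow_le hq0 hq1 hiso (ridgeGram_posDef ha x idx) (fun i => ?_) ht
      have h1 : x i ⬝ᵥ (ridgeGram a x idx)⁻¹ *ᵥ x i ≤ L / a :=
        (dotProduct_ridgeGram_inv_le ha x idx (x i)).trans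
          (div_le_div_of_nonneg_right (hx i) ha.le)
      have h2 : ((p : ℝ) + 1) * (L / a) ≤ 1 / 2 := by
        rw [← mul_div_assoc, div_le_iff₀ ha]
        linarith
      exact (mul_le_mul_of_nonneg_left h1 (by positivity)).trans h2
    have h3 : ∑ idx : Fin k → ι, (∏ j, q (idx j)) *
        ∑ i, q i * ((ridgeGram a x (Fin.snoc (α := fun _ => ι) idx i))⁻¹ ^ p).trace
        ≤ (1 - p / 2 * t) *
            ∑ idx : Fin k → ι, (∏ j, q (idx j)) * ((ridgeGram a x idx)⁻¹ ^ p).trace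
          + p / 2 * (Fintype.card κ * t ^ (p + 1)) := by
      refine (Finset.sum_le_sum fun idx _ => mul_le_mul_of_nonneg_left (hstep idx)
        (Finset.prod_nonneg fun j _ => hq0 _)).trans (le_of_eq ?_)
      simp only [mul_add, Finset.sum_add_distrib]
      rw [← Finset.sum_mul, sum_prod_eq_one hq1, Finset.mul_sum, one_mul]
      congr 1
      exact Finset.sum_congr rfl fun _ _ => by ring
    refine h3.trans ?_
    have h4 := mul_le_mul_of_nonneg_left ih (by linarith : (0 : ℝ) ≤ 1 - p / 2 * t)
    refine (add_le_add_left h4 _).trans (le_of_eq ?_)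
    ring

open Classical in
/-- The lower tail of the Gram matrix of independent samples of a bounded isotropic vector. -/
theorem sum_prod_gram_lower_tail {ι κ : Type*} [Fintype ι] [DecidableEq ι] [Fintype κ]
    [DecidableEq κ]
    [Nonempty κ] {q : ι → ℝ} {x : ι → κ → ℝ}
    (hq0 : ∀ i, 0 ≤ q i) (hq1 : ∑ i, q i = 1) (hiso : ∑ i, q i • vecMulVec (x i) (x i) = 1)
    {L : ℝ} (hx : ∀ i, x i ⬝ᵥ x i ≤ L) {p r : ℕ} (hp : 12 * Fintype.card κ ≤ 2 ^ p)
    (hr : 32 * (p + 1) * L ≤ r) (hpr : 2 * p ≤ r) :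
    ∑ idx : Fin r → ι with ¬ ∀ v : κ → ℝ, (r : ℝ) / 16 * (v ⬝ᵥ v) ≤
      ∑ j, (x (idx j) ⬝ᵥ v) ^ 2, ∏ j, q (idx j) ≤ 1 / 6 := by
  have hκ : 0 < Fintype.card κ := Fintype.card_pos
  have hp0 : p ≠ 0 := by
    rintro rfl
    simp at hp
    omega
  have hr0 : 0 < r := by omega
  have hrR : (0 : ℝ) < r := by exact_mod_cast hr0
  -- With `t = 4 / r` the contraction over `r` samples is at most `e^{-2p} ≤ 4^{-p}`, which brings
  -- the initial value `(16 / r) ^ p` down to `(4 / r) ^ p`, the size of the fixed point.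
  have hφ := sum_prod_mul_trace_ridgeGram_inv_pow_le hq0 hq1 hiso hx (p := p) (a := r / 16)
    (t := 4 / r) (by positivity) (by linarith) (by positivity)
    (by
      have : (2 : ℝ) * p ≤ r := by exact_mod_cast hpr
      rw [show (p : ℝ) / 2 * (4 / r) = 2 * p / r by ring]
      exact (div_le_one hrR).2 this) r
  have hexp : (1 - p / 2 * (4 / r)) ^ r * ((r : ℝ) / 16)⁻¹ ^ p ≤ (4 / (r : ℝ)) ^ p := by
    have h1 : (1 - (p : ℝ) / 2 * (4 / r)) ^ r ≤ Real.exp (-(2 * p)) := by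
      have := Real.one_sub_div_pow_le_exp_neg (n := r) (t := 2 * p) (by exact_mod_cast hpr)
      rwa [show (p : ℝ) / 2 * (4 / r) = 2 * p / r by ring]
    have h2 : Real.exp (-(2 * p)) = Real.exp (-2) ^ p := by
      rw [← Real.exp_nat_mul]
      ring_nf
    have h3 : Real.exp (-2) ≤ 1 / 4 := by
      have h4 : (2 : ℝ) ≤ Real.exp 1 := by
        have := Real.add_one_le_exp (1 : ℝ)
        linarith
      have h5 : Real.exp 2 = Real.exp 1 * Real.exp 1 := by
        rw [← Real.exp_add]
        norm_num
      rw [Real.exp_neg, one_div]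
      refine inv_anti₀ (by norm_num) ?_
      nlinarith
    calc _ ≤ (1 / 4 : ℝ) ^ p * ((r : ℝ) / 16)⁻¹ ^ p := by
          refine mul_le_mul_of_nonneg_right ?_ (by positivity)
          rw [h2] at h1
          exact h1.trans (pow_le_pow_left₀ (Real.exp_pos _).le h3 p)
      _ = (4 / (r : ℝ)) ^ p := by
          rw [← mul_pow]
          congr 1
          field_simp
          norm_num
  have hφ' : ∑ idx : Fin r → ι, (∏ j, q (idx j)) * ((ridgeGram (r / 16) x idx)⁻¹ ^ p).trace
      ≤ 2 * Fintype.card κ * (4 / (r : ℝ)) ^ p := by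
    refine hφ.trans ?_
    have := mul_le_mul_of_nonneg_left hexp (Nat.cast_nonneg (α := ℝ) (Fintype.card κ))
    linarith
  set bad := Finset.univ.filter fun idx : Fin r → ι => ¬ ∀ v : κ → ℝ,
    (r : ℝ) / 16 * (v ⬝ᵥ v) ≤ ∑ j, (x (idx j) ⬝ᵥ v) ^ 2 with hbad
  have hw : ∀ idx : Fin r → ι, 0 ≤ ∏ j, q (idx j) := fun idx =>
    Finset.prod_nonneg fun j _ => hq0 _
  have hpos : (0 : ℝ) < r / 16 := by positivity
  have hlarge : ∀ idx ∈ bad, (8 / (r : ℝ)) ^ p ≤ ((ridgeGram (r / 16) x idx)⁻¹ ^ p).trace := by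
    intro idx hidx
    by_contra hcon
    push Not at hcon
    rw [hbad, Finset.mem_filter] at hidx
    refine hidx.2 fun v => ?_
    -- The regularized matrix is at least `r / 8`; removing the ridge `r / 16` leaves `r / 16`.
    have h1 := (ridgeGram_posDef hpos x idx).le_of_trace_inv_pow_le (b := r / 8) (by positivity)
      hp0 (by rw [inv_div]; exact hcon.le) v
    rw [dotProduct_ridgeGram_mulVec] at h1
    linarith
  -- Markov's inequality. The threshold `(8 / r) ^ p` exceeds `(4 / r) ^ p` by the factor `2 ^ p ≥
  -- 12 card κ`, which gives `2 card κ / 2 ^ p ≤ 1 / 6`.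
  have hmarkov : (∑ idx ∈ bad, ∏ j, q (idx j)) * (8 / (r : ℝ)) ^ p
      ≤ 2 * Fintype.card κ * (4 / (r : ℝ)) ^ p := by
    refine le_trans ?_ hφ'
    rw [Finset.sum_mul]
    refine (Finset.sum_le_sum fun idx hidx =>
      mul_le_mul_of_nonneg_left (hlarge idx hidx) (hw idx)).trans ?_
    refine Finset.sum_le_sum_of_subset_of_nonneg (Finset.subset_univ _) fun idx _ _ => ?_
    exact mul_nonneg (hw idx)
      ((ridgeGram_posDef hpos x idx).inv.posSemidef.pow p).trace_nonneg
  have h8 : (8 / (r : ℝ)) ^ p = 2 ^ p * (4 / (r : ℝ)) ^ p := by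
    rw [← mul_pow]
    congr 1
    ring
  have h4 : (0 : ℝ) < (4 / (r : ℝ)) ^ p := by positivity
  rw [h8, ← mul_assoc] at hmarkov
  have h5 := le_of_mul_le_mul_right hmarkov h4
  have h6 : (12 : ℝ) * Fintype.card κ ≤ 2 ^ p := by exact_mod_cast hp
  have h7 : 0 ≤ ∑ idx ∈ bad, ∏ j, q (idx j) := Finset.sum_nonneg fun idx _ => hw idx
  have h9 : (0 : ℝ) < Fintype.card κ := by exact_mod_cast hκ
  by_contra hcon
  push Not at hcon
  nlinarith

end LowerTail

/-! ### Least squares and the effect of sampling. -/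

section LeastSquares

open Matrix

theorem sqDist_eq_dotProduct {ι : Type*} [Fintype ι] (u v : ι → ℝ) :
    sqDist u v = (u - v) ⬝ᵥ (u - v) := by
  simp only [sqDist, dotProduct, Pi.sub_apply, sq]

theorem sqDist_nonneg {ι : Type*} [Fintype ι] (u v : ι → ℝ) : 0 ≤ sqDist u v :=
  Finset.sum_nonneg fun _ _ => sq_nonneg _

theorem real_dotProduct_self_nonneg {ι : Type*} [Fintype ι] (u : ι → ℝ) : 0 ≤ u ⬝ᵥ u :=
  Finset.sum_nonneg fun _ _ => mul_self_nonneg _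

theorem sub_dotProduct_sub_self {ι : Type*} [Fintype ι] (u v : ι → ℝ) :
    (u - v) ⬝ᵥ (u - v) = u ⬝ᵥ u - 2 * (u ⬝ᵥ v) + v ⬝ᵥ v := by
  rw [sub_dotProduct, dotProduct_sub, dotProduct_sub, dotProduct_comm v u]
  ring

/-- The normal equations. -/
theorem isLeastSquares_iff {m d : ℕ} (M : Matrix (Fin m) (Fin d) ℝ) (b : Fin m → ℝ)
    (w : Fin d → ℝ) : IsLeastSquares M b w ↔ ∀ u, (M *ᵥ u) ⬝ᵥ (b - M *ᵥ w) = 0 := by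
  have hexp : ∀ u, sqDist (M *ᵥ (w + u)) b
      = sqDist (M *ᵥ w) b - 2 * ((M *ᵥ u) ⬝ᵥ (b - M *ᵥ w)) + (M *ᵥ u) ⬝ᵥ (M *ᵥ u) := by
    intro u
    rw [sqDist_eq_dotProduct, sqDist_eq_dotProduct, mulVec_add,
      show M *ᵥ w + M *ᵥ u - b = M *ᵥ u - (b - M *ᵥ w) by abel,
      show M *ᵥ w - b = -(b - M *ᵥ w) by abel]
    rw [sub_dotProduct_sub_self, neg_dotProduct_neg]
    ring
  constructor
  · intro h u
    have h1 : ∀ τ : ℝ, 0 ≤ ((M *ᵥ u) ⬝ᵥ (M *ᵥ u)) * (τ * τ)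
        + -2 * ((M *ᵥ u) ⬝ᵥ (b - M *ᵥ w)) * τ + 0 := by
      intro τ
      have h2 := h (w + τ • u)
      rw [hexp, mulVec_smul, smul_dotProduct, smul_dotProduct, dotProduct_smul] at h2
      simp only [smul_eq_mul] at h2
      linarith
    have h3 := discrim_le_zero h1
    rw [discrim] at h3
    nlinarith [sq_nonneg ((M *ᵥ u) ⬝ᵥ (b - M *ᵥ w))]
  · intro h w'
    have h1 := hexp (w' - w)
    rw [add_sub_cancel, h] at h1
    have := real_dotProduct_self_nonneg (M *ᵥ (w' - w))
    linarith

theorem colDistSq_le {n d : ℕ} (A : Matrix (Fin n) (Fin d) ℝ) (x : Fin n → ℝ) (w : Fin d → ℝ) :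
    colDistSq A x ≤ sqDist (A *ᵥ w) x :=
  ciInf_le ⟨0, by rintro _ ⟨w, rfl⟩; exact sqDist_nonneg _ _⟩ w

theorem IsLeastSquares.sqDist_eq {n d : ℕ} {A : Matrix (Fin n) (Fin d) ℝ} {x : Fin n → ℝ}
    {w : Fin d → ℝ} (h : IsLeastSquares A x w) : sqDist (A *ᵥ w) x = colDistSq A x :=
  le_antisymm (le_ciInf h) (colDistSq_le A x w)

/-- Full rank makes `N` surjective, so minimizing over `w` is the same as minimizing over the
coordinates `z = N w` with respect to `U`. -/
theorem exists_mulVec_eq_of_rank_mul {n d : ℕ} {U : Matrix (Fin n) (Fin d) ℝ}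
    {N : Matrix (Fin d) (Fin d) ℝ} (h : (U * N).rank = d) (z : Fin d → ℝ) :
    ∃ w, N *ᵥ w = z := by
  have h1 : N.rank = d := le_antisymm (by simpa using N.rank_le_width)
    (h.symm.le.trans (rank_mul_le_right U N))
  have h2 : LinearMap.range N.mulVecLin = ⊤ := by
    refine Submodule.eq_top_of_finrank_eq ?_
    rw [← Matrix.rank, h1]
    simp
  obtain ⟨w, hw⟩ := LinearMap.range_eq_top.1 h2 z
  exact ⟨w, by simpa using hw⟩

/-- Pythagoras for the projection onto the span of orthonormal columns. -/
theorem sqDist_orthonormal_mulVec {n d : ℕ} {U : Matrix (Fin n) (Fin d) ℝ} (hU : Uᵀ * U = 1)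
    (b : Fin n → ℝ) (z : Fin d → ℝ) :
    sqDist (U *ᵥ z) b = (z - Uᵀ *ᵥ b) ⬝ᵥ (z - Uᵀ *ᵥ b)
      + (b - U *ᵥ (Uᵀ *ᵥ b)) ⬝ᵥ (b - U *ᵥ (Uᵀ *ᵥ b)) := by
  set e := b - U *ᵥ (Uᵀ *ᵥ b) with he
  have h0 : Uᵀ *ᵥ e = 0 := by
    rw [he, mulVec_sub, mulVec_mulVec, hU, one_mulVec, sub_self]
  set β := z - Uᵀ *ᵥ b with hβ
  have h1 : U *ᵥ z - b = U *ᵥ β - e := by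
    rw [hβ, he, mulVec_sub]
    abel
  have h2 : (U *ᵥ β) ⬝ᵥ e = 0 := by
    rw [dotProduct_comm, dotProduct_mulVec, ← mulVec_transpose, h0, zero_dotProduct]
  have h3 : (U *ᵥ β) ⬝ᵥ (U *ᵥ β) = β ⬝ᵥ β := by
    rw [dotProduct_mulVec, ← mulVec_transpose, mulVec_mulVec, hU, one_mulVec]
  rw [sqDist_eq_dotProduct, h1, sub_dotProduct_sub_self, h2, h3]
  ring

theorem colDistSq_eq_residual {n d : ℕ} {U : Matrix (Fin n) (Fin d) ℝ} (hU : Uᵀ * U = 1)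
    {N : Matrix (Fin d) (Fin d) ℝ} (h : (U * N).rank = d) (b : Fin n → ℝ) :
    colDistSq (U * N) b = (b - U *ᵥ (Uᵀ *ᵥ b)) ⬝ᵥ (b - U *ᵥ (Uᵀ *ᵥ b)) := by
  refine le_antisymm ?_ (le_ciInf fun w => ?_)
  · obtain ⟨w, hw⟩ := exists_mulVec_eq_of_rank_mul h (Uᵀ *ᵥ b)
    refine (colDistSq_le _ b w).trans (le_of_eq ?_)
    rw [← mulVec_mulVec, hw, sqDist_orthonormal_mulVec hU]
    simp
  · rw [← mulVec_mulVec, sqDist_orthonormal_mulVec hU]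
    have := real_dotProduct_self_nonneg (N *ᵥ w - Uᵀ *ᵥ b)
    linarith

/-- The rescaled sampled regression problem, row by row. -/
theorem rescaled_mulVec_apply {n d r : ℕ} (P : PMF (Fin n)) (idx : Fin r → Fin n)
    (A : Matrix (Fin n) (Fin d) ℝ) (u : Fin d → ℝ) (j : Fin r) :
    ((rescalingMatrix P idx * samplingMatrix idx * A) *ᵥ u) j
      = 1 / Real.sqrt (r * (P (idx j)).toReal) * (A *ᵥ u) (idx j) := by
  rw [Matrix.mul_assoc, ← mulVec_mulVec, rescalingMatrix, mulVec_diagonal, ← mulVec_mulVec]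
  congr 1
  simp [samplingMatrix, mulVec, dotProduct]

/-- If the sampled Gram matrix is well conditioned and the sampled residual is nearly orthogonal to
the column space, then the sampled regression is nearly optimal for the full problem. -/
theorem sqDist_le_of_sampled_leastSquares {n d r : ℕ} {U : Matrix (Fin n) (Fin d) ℝ}
    (hU : Uᵀ * U = 1) {N : Matrix (Fin d) (Fin d) ℝ} (hN : (U * N).rank = d) {P : PMF (Fin n)}
    {idx : Fin r → Fin n} (hr : 0 < r) (b : Fin n → ℝ) {ε : ℝ}
    (hgram : ∀ v : Fin d → ℝ, (r : ℝ) / 16 * (v ⬝ᵥ v) ≤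
      ∑ j, (((Real.sqrt (P (idx j)).toReal)⁻¹ • U (idx j)) ⬝ᵥ v) ^ 2)
    (hres : (∑ j, (((P (idx j)).toReal)⁻¹ * (b - U *ᵥ (Uᵀ *ᵥ b)) (idx j)) • U (idx j)) ⬝ᵥ
      (∑ j, (((P (idx j)).toReal)⁻¹ * (b - U *ᵥ (Uᵀ *ᵥ b)) (idx j)) • U (idx j))
      ≤ (r : ℝ) ^ 2 * ε / 256 * colDistSq (U * N) b)
    {w : Fin d → ℝ}
    (hw : IsLeastSquares (rescalingMatrix P idx * samplingMatrix idx * (U * N))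
      ((rescalingMatrix P idx).mulVec fun j => b (idx j)) w) :
    sqDist ((U * N) *ᵥ w) b ≤ (1 + ε) * colDistSq (U * N) b := by
  have hrR : (0 : ℝ) < r := by exact_mod_cast hr
  rw [isLeastSquares_iff] at hw
  rw [colDistSq_eq_residual hU hN] at hres ⊢
  rw [← mulVec_mulVec, sqDist_orthonormal_mulVec hU]
  set e := b - U *ᵥ (Uᵀ *ᵥ b) with he
  set β := N *ᵥ w - Uᵀ *ᵥ b with hβ
  set Y := ∑ j, (((P (idx j)).toReal)⁻¹ * e (idx j)) • U (idx j) with hY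
  obtain ⟨u, hu⟩ := exists_mulVec_eq_of_rank_mul hN β
  have hb : b - U *ᵥ (N *ᵥ w) = e - U *ᵥ β := by
    rw [he, hβ, mulVec_sub]
    abel
  have h1 := hw u
  -- The normal equations, tested in the direction `β` of the error itself.
  have h2 : ∑ j, (1 / Real.sqrt (r * (P (idx j)).toReal)) ^ 2 *
      ((U *ᵥ β) (idx j) * (e (idx j) - (U *ᵥ β) (idx j))) = 0 := by
    rw [← h1, dotProduct]
    refine Finset.sum_congr rfl fun j _ => ?_
    rw [Pi.sub_apply, rescaled_mulVec_apply, rescaled_mulVec_apply, rescalingMatrix,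
      mulVec_diagonal, ← mulVec_mulVec, ← mulVec_mulVec, hu, ← mul_sub]
    have h3 := congrFun hb (idx j)
    simp only [Pi.sub_apply] at h3
    rw [h3]
    ring
  have h3 : ∀ j, (1 / Real.sqrt (r * (P (idx j)).toReal)) ^ 2
      = (r : ℝ)⁻¹ * ((P (idx j)).toReal)⁻¹ := by
    intro j
    rw [div_pow, Real.sq_sqrt (by positivity), one_pow, one_div, mul_inv]
  have h4 : ∑ j, ((P (idx j)).toReal)⁻¹ * ((U *ᵥ β) (idx j) * (e (idx j) - (U *ᵥ β) (idx j)))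
      = 0 := by
    simp only [h3, mul_assoc] at h2
    rw [← Finset.mul_sum] at h2
    exact (mul_eq_zero.1 h2).resolve_left (inv_ne_zero hrR.ne')
  have h5 : ∑ j, (((Real.sqrt (P (idx j)).toReal)⁻¹ • U (idx j)) ⬝ᵥ β) ^ 2 = Y ⬝ᵥ β := by
    rw [hY, sum_dotProduct, ← sub_eq_zero, ← Finset.sum_sub_distrib, ← neg_eq_zero,
      ← Finset.sum_neg_distrib, ← h4]
    refine Finset.sum_congr rfl fun j _ => ?_
    have h6 : (U *ᵥ β) (idx j) = U (idx j) ⬝ᵥ β := rfl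
    rw [smul_dotProduct, smul_dotProduct, h6, smul_eq_mul, smul_eq_mul, mul_pow, inv_pow,
      Real.sq_sqrt ENNReal.toReal_nonneg]
    ring
  have h6 := hgram β
  rw [h5] at h6
  -- Together with `(r / 16) ‖β‖² ≤ ⟨Y, β⟩` this square plays the part of Cauchy–Schwarz and yields
  -- `(r / 16)² ‖β‖² ≤ ‖Y‖²`.
  have h7 := real_dotProduct_self_nonneg (((r : ℝ) / 16) • β - Y)
  rw [sub_dotProduct_sub_self, smul_dotProduct, dotProduct_smul, smul_dotProduct,
    dotProduct_comm β Y] at h7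
  simp only [smul_eq_mul] at h7
  have h8 : ((r : ℝ) / 16) ^ 2 * (β ⬝ᵥ β) ≤ Y ⬝ᵥ Y := by
    have := mul_le_mul_of_nonneg_left h6 (by positivity : (0 : ℝ) ≤ r / 16)
    linarith
  have h9 : β ⬝ᵥ β ≤ ε * (e ⬝ᵥ e) := by
    have h10 : ((r : ℝ) / 16) ^ 2 * (β ⬝ᵥ β) ≤ ((r : ℝ) / 16) ^ 2 * (ε * (e ⬝ᵥ e)) := by
      refine h8.trans (hres.trans (le_of_eq ?_))
      ring
    exact le_of_mul_le_mul_left h10 (by positivity)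
  linarith

end LeastSquares

/-! ### From regression to binary vectors. -/

section Rounding

open Matrix

theorem single_zero_mem_nonzeroBinary (n : ℕ) [NeZero n] :
    (Pi.single 0 1 : Fin n → ℝ) ∈ nonzeroBinary n := by
  refine ⟨fun i => ?_, fun h => ?_⟩
  · by_cases h : i = 0
    · subst h; simp
    · simp [h]
  · have := congrFun h 0
    simp at this

theorem IsRounding.mem_nonzeroBinary {n r : ℕ} {idx : Fin r → Fin n} {x' : Fin r → ℝ}
    {y x : Fin n → ℝ} (h : IsRounding idx x' y x) (hx' : x' ∈ nonzeroBinary r) :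
    x ∈ nonzeroBinary n := by
  refine ⟨fun i => ?_, h.ne_zero⟩
  by_cases hi : i ∈ Set.range idx
  · obtain ⟨j, -, hj⟩ := h.sampled i hi
    rw [hj]
    exact hx'.1 j
  · rcases lt_or_ge (y i) (1 / 2) with hy | hy
    · exact Or.inl (h.low i hi hy)
    · exact Or.inr (h.high i hi hy)

/-- Rounding is at least as close to `y` as every binary vector that agrees with `x'` on the
sampled rows. -/
theorem IsRounding.sqDist_le {n r : ℕ} {idx : Fin r → Fin n} {b y x : Fin n → ℝ}
    (h : IsRounding idx (fun j => b (idx j)) y x) (hb : ∀ i, b i = 0 ∨ b i = 1) :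
    sqDist y x ≤ sqDist y b := by
  refine Finset.sum_le_sum fun i _ => ?_
  by_cases hi : i ∈ Set.range idx
  · obtain ⟨j, rfl, hj⟩ := h.sampled i hi
    rw [hj]
  · rcases lt_or_ge (y i) (1 / 2) with hy | hy
    · rw [h.low i hi hy]
      rcases hb i with h1 | h1
      · rw [h1]
      · rw [h1]
        nlinarith
    · rw [h.high i hi hy]
      rcases hb i with h1 | h1
      · rw [h1]
        nlinarith
      · rw [h1]

theorem IsSearchOutput.mem_nonzeroBinary {n d r : ℕ} [NeZero n] {A : Matrix (Fin n) (Fin d) ℝ}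
    {P : PMF (Fin n)} {idx : Fin r → Fin n} {xs : Fin n → ℝ} (h : IsSearchOutput A P idx xs) :
    xs ∈ nonzeroBinary n := by
  obtain ⟨w, x, hwx, hmem, -⟩ := h
  rcases hmem with rfl | ⟨x', hx', rfl⟩
  · exact single_zero_mem_nonzeroBinary n
  · exact (hwx x' hx').2.mem_nonzeroBinary hx'

/-- If regression on the sampled rows approximates the projection of the binary vector `b`, then
the search phase finds a binary vector that is almost as close to the column space. -/
theorem IsSearchOutput.colDistSq_le_of_regression {n d r : ℕ} [NeZero n]
    {A : Matrix (Fin n) (Fin d) ℝ} {P : PMF (Fin n)} {idx : Fin r → Fin n} {xs b : Fin n → ℝ}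
    (h : IsSearchOutput A P idx xs) (hb : b ∈ nonzeroBinary n) {η : ℝ}
    (hreg : ∀ w, IsLeastSquares (rescalingMatrix P idx * samplingMatrix idx * A)
      ((rescalingMatrix P idx).mulVec fun j => b (idx j)) w → sqDist (A *ᵥ w) b ≤ η) :
    colDistSq A xs ≤ η := by
  obtain ⟨w, x, hwx, -, hmin⟩ := h
  -- The zero vector is not enumerated. In this case `w = 0` is a sampled regression solution, so `1
  -- ≤ ‖b‖² ≤ η`, and the default candidate, a unit vector, already has squared distance at most
  -- `1`.
  by_cases h0 : (fun j => b (idx j)) = 0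
  · have hls : IsLeastSquares (rescalingMatrix P idx * samplingMatrix idx * A)
        ((rescalingMatrix P idx).mulVec fun j => b (idx j)) 0 := by
      rw [isLeastSquares_iff, h0]
      simp
    have h1 := hreg 0 hls
    have h2 : colDistSq A xs ≤ colDistSq A (Pi.single 0 1) :=
      hmin (Set.mem_insert _ _)
    have h3 : sqDist (A *ᵥ 0) (Pi.single 0 1 : Fin n → ℝ) = 1 := by
      rw [sqDist_eq_dotProduct]
      simp
    have h4 : 1 ≤ sqDist (A *ᵥ 0) b := by
      obtain ⟨i, hi⟩ : ∃ i, b i ≠ 0 := by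
        by_contra hcon
        push Not at hcon
        exact hb.2 (funext hcon)
      have hi1 := (hb.1 i).resolve_left hi
      calc (1 : ℝ) = ((A *ᵥ 0) i - b i) ^ 2 := by rw [hi1]; simp
        _ ≤ _ := Finset.single_le_sum (f := fun i => ((A *ᵥ 0) i - b i) ^ 2)
          (fun i _ => sq_nonneg _) (Finset.mem_univ i)
    exact (h2.trans ((colDistSq_le _ _ 0).trans h3.le)).trans (h4.trans h1)
  · have hx' : (fun j => b (idx j)) ∈ nonzeroBinary r := ⟨fun j => hb.1 _, h0⟩
    have h1 := hwx _ hx'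
    calc colDistSq A xs ≤ colDistSq A (x fun j => b (idx j)) :=
          hmin (Set.mem_insert_of_mem _ (Set.mem_image_of_mem x hx'))
      _ ≤ sqDist (A *ᵥ w fun j => b (idx j)) (x fun j => b (idx j)) := colDistSq_le _ _ _
      _ ≤ sqDist (A *ᵥ w fun j => b (idx j)) b := h1.2.sqDist_le hb.1
      _ ≤ η := hreg _ h1.1

end Rounding

/-! ### Success probability. -/

section Success

open Matrix

theorem iidLaw_apply_eq_ofReal {n : ℕ} (P : PMF (Fin n)) (r : ℕ) (idx : Fin r → Fin n) :
    iidLaw P r idx = ENNReal.ofReal (∏ j, (P (idx j)).toReal) := by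
  rw [iidLaw, PMF.ofFintype_apply, ENNReal.ofReal_prod_of_nonneg fun _ _ => ENNReal.toReal_nonneg]
  exact Finset.prod_congr rfl fun j _ => (ENNReal.ofReal_toReal (P.apply_ne_top _)).symm

theorem PMF.sum_toReal_eq_one {ι : Type*} [Fintype ι] (P : PMF ι) : ∑ i, (P i).toReal = 1 := by
  rw [← ENNReal.toReal_sum fun i _ => P.apply_ne_top i, ← tsum_fintype (L := .unconditional _),
    P.tsum_coe, ENNReal.toReal_one]

theorem ofReal_sum_le_toOuterMeasure_map {n r : ℕ} {α : Type*} (P : PMF (Fin n))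
    (out : (Fin r → Fin n) → α) (T : Set α) (G : Finset (Fin r → Fin n))
    (hG : ∀ idx ∈ G, (∀ j, P (idx j) ≠ 0) → out idx ∈ T) :
    ENNReal.ofReal (∑ idx ∈ G, ∏ j, (P (idx j)).toReal)
      ≤ ((iidLaw P r).map out).toOuterMeasure T := by
  rw [PMF.toOuterMeasure_map_apply]
  refine le_trans ?_ (PMF.toOuterMeasure_mono (s := (G : Set (Fin r → Fin n))) _ ?_)
  · rw [PMF.toOuterMeasure_apply_finset,
      ENNReal.ofReal_sum_of_nonneg fun _ _ => Finset.prod_nonneg fun _ _ => ENNReal.toReal_nonneg]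
    exact Finset.sum_le_sum fun idx _ => (iidLaw_apply_eq_ofReal P r idx).ge
  · rintro idx ⟨hidx, hsupp⟩
    refine hG idx hidx fun j hj => ?_
    rw [PMF.mem_support_iff, iidLaw_apply_eq_ofReal] at hsupp
    refine hsupp ?_
    rw [Finset.prod_eq_zero (Finset.mem_univ j) (by rw [hj]; rfl), ENNReal.ofReal_zero]

-- The vectors `(e_i / p_i) U_i` have mean `Uᵀ e = 0` and second moment at most `d ‖e‖²`, because
-- `‖U_i‖² = d p_i`. Markov's inequality then bounds the failure by `256 d / (r ε)`, whence `1536 =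
-- 6 * 256`.
open Classical in
theorem sum_prod_residual_tail {n d r : ℕ} {U : Matrix (Fin n) (Fin d) ℝ} {P : PMF (Fin n)}
    (hd : 1 ≤ d) (hP : ∀ i, (P i).toReal = (∑ j, U i j ^ 2) / d)
    {e : Fin n → ℝ} (he : Uᵀ *ᵥ e = 0) {ε : ℝ} (hε : 0 < ε) (hr : 0 < r)
    (hrε : 1536 * d ≤ r * ε) :
    ∑ idx : Fin r → Fin n with ¬ (∑ j, (((P (idx j)).toReal)⁻¹ * e (idx j)) • U (idx j)) ⬝ᵥ
      (∑ j, (((P (idx j)).toReal)⁻¹ * e (idx j)) • U (idx j)) ≤ (r : ℝ) ^ 2 * ε / 256 * (e ⬝ᵥ e),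
      ∏ j, (P (idx j)).toReal ≤ 1 / 6 := by
  have hdR : (0 : ℝ) < d := by exact_mod_cast hd
  have hrR : (0 : ℝ) < r := by exact_mod_cast hr
  set q := fun i => (P i).toReal with hq
  set y : Fin n → Fin d → ℝ := fun i => ((q i)⁻¹ * e i) • U i with hy
  have hq0 : ∀ i, 0 ≤ q i := fun i => ENNReal.toReal_nonneg
  have hzero : ∀ i, q i = 0 → U i = 0 := by
    intro i hi
    have h1 := hP i
    change q i = _ at h1
    rw [hi, eq_comm, div_eq_zero_iff, or_iff_left hdR.ne',
      Finset.sum_eq_zero_iff_of_nonneg fun _ _ => sq_nonneg _] at h1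
    ext j
    simpa using h1 j (Finset.mem_univ j)
  have hmean : ∑ i, q i • y i = 0 := by
    rw [← he]
    ext k
    simp only [Finset.sum_apply, Pi.smul_apply, smul_eq_mul, hy, mulVec, dotProduct,
      transpose_apply]
    refine Finset.sum_congr rfl fun i _ => ?_
    by_cases hi : q i = 0
    · simp [hzero i hi]
    · field_simp
  -- Only an inequality: rows with `q i = 0` contribute nothing on the left, but `e i` may be
  -- nonzero there.
  have hvar : ∑ i, q i * (y i ⬝ᵥ y i) ≤ d * (e ⬝ᵥ e) := by
    rw [dotProduct, Finset.mul_sum]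
    refine Finset.sum_le_sum fun i _ => ?_
    have h1 : y i ⬝ᵥ y i = ((q i)⁻¹ * e i) ^ 2 * ∑ j, U i j ^ 2 := by
      rw [hy, smul_dotProduct, dotProduct_smul, smul_eq_mul, smul_eq_mul, dotProduct]
      simp only [← sq]
      ring
    have h2 : ∑ j, U i j ^ 2 = d * q i := by
      rw [hq]
      simp only [hP]
      field_simp
    rw [h1, h2]
    by_cases hi : q i = 0
    · rw [hi]
      have := mul_self_nonneg (e i)
      simp only [zero_mul]
      positivity
    · refine le_of_eq ?_
      field_simp
  have hsum := sum_prod_mul_norm_sq P.sum_toReal_eq_one hmean r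
  have hw : ∀ idx : Fin r → Fin n, 0 ≤ ∏ j, q (idx j) := fun idx =>
    Finset.prod_nonneg fun j _ => hq0 _
  -- Markov's inequality needs a positive threshold; for `e = 0` the bad event is empty.
  by_cases hee : e ⬝ᵥ e = 0
  · have he0 : e = 0 := dotProduct_self_eq_zero.1 hee
    rw [Finset.filter_eq_empty_iff.2]
    · simp
    · intro idx _
      simp [he0]
  have hepos : 0 < e ⬝ᵥ e := lt_of_le_of_ne (real_dotProduct_self_nonneg e) (Ne.symm hee)
  set bad := Finset.univ.filter fun idx : Fin r → Fin n =>
    ¬ (∑ j, y (idx j)) ⬝ᵥ (∑ j, y (idx j)) ≤ (r : ℝ) ^ 2 * ε / 256 * (e ⬝ᵥ e) with hbad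
  have hmarkov : (∑ idx ∈ bad, ∏ j, q (idx j)) * ((r : ℝ) ^ 2 * ε / 256 * (e ⬝ᵥ e))
      ≤ r * (d * (e ⬝ᵥ e)) := by
    refine le_trans ?_ (mul_le_mul_of_nonneg_left hvar hrR.le)
    rw [← hsum, Finset.sum_mul]
    refine (Finset.sum_le_sum fun idx hidx => mul_le_mul_of_nonneg_left
      (not_le.1 (Finset.mem_filter.1 hidx).2).le (hw idx)).trans ?_
    refine Finset.sum_le_sum_of_subset_of_nonneg (Finset.subset_univ _) fun idx _ _ => ?_
    exact mul_nonneg (hw idx) (real_dotProduct_self_nonneg _)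
  have h1 : (∑ idx ∈ bad, ∏ j, q (idx j)) * (r * ε) ≤ 256 * d := by
    have h2 : (r * (e ⬝ᵥ e)) * ((∑ idx ∈ bad, ∏ j, q (idx j)) * (r * ε))
        ≤ (r * (e ⬝ᵥ e)) * (256 * d) := by linarith
    exact le_of_mul_le_mul_left h2 (by positivity)
  have h3 : 0 < (r : ℝ) * ε := by positivity
  change ∑ idx ∈ bad, ∏ j, q (idx j) ≤ 1 / 6
  by_contra hcon
  push Not at hcon
  nlinarith

-- The vectors `U_i / √p_i` are isotropic because `Uᵀ U = 1`, and leverage sampling makes their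
-- squared norms equal to `d` whenever `p_i ≠ 0`, so the general bound applies with `L = d`.
open Classical in
theorem sum_prod_leverage_gram_tail {n d r : ℕ} {U : Matrix (Fin n) (Fin d) ℝ}
    (hU : Uᵀ * U = 1) {P : PMF (Fin n)} (hd : 1 ≤ d)
    (hP : ∀ i, (P i).toReal = (∑ j, U i j ^ 2) / d) {p : ℕ} (hp : 12 * d ≤ 2 ^ p)
    (hr : 32 * ((p : ℝ) + 1) * d ≤ r) :
    ∑ idx : Fin r → Fin n with ¬ ∀ v : Fin d → ℝ, (r : ℝ) / 16 * (v ⬝ᵥ v) ≤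
      ∑ j, (((Real.sqrt (P (idx j)).toReal)⁻¹ • U (idx j)) ⬝ᵥ v) ^ 2,
      ∏ j, (P (idx j)).toReal ≤ 1 / 6 := by
  have hdR : (1 : ℝ) ≤ d := by exact_mod_cast hd
  have : Nonempty (Fin d) := ⟨⟨0, hd⟩⟩
  set q := fun i => (P i).toReal with hq
  have hq0 : ∀ i, 0 ≤ q i := fun i => ENNReal.toReal_nonneg
  have hnorm : ∀ i, ∑ j, U i j ^ 2 = d * q i := by
    intro i
    rw [hq]
    simp only [hP]
    field_simp
  have hzero : ∀ i, q i = 0 → U i = 0 := by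
    intro i hi
    have h1 := hnorm i
    rw [hi, mul_zero, Finset.sum_eq_zero_iff_of_nonneg fun _ _ => sq_nonneg _] at h1
    ext j
    simpa using h1 j (Finset.mem_univ j)
  refine sum_prod_gram_lower_tail (q := q) (x := fun i => (Real.sqrt (q i))⁻¹ • U i) (L := d)
    hq0 P.sum_toReal_eq_one ?_ (fun i => ?_) (by simpa using hp) (by simpa using hr) ?_
  · ext k l
    have h1 := congrFun (congrFun hU k) l
    rw [← h1, Matrix.sum_apply, Matrix.mul_apply]
    refine Finset.sum_congr rfl fun i _ => ?_
    rw [Matrix.smul_apply, vecMulVec_apply, transpose_apply]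
    simp only [Pi.smul_apply, smul_eq_mul]
    by_cases hi : q i = 0
    · simp [hzero i hi]
    · have h2 : 0 < q i := lt_of_le_of_ne (hq0 i) (Ne.symm hi)
      have h3 := Real.mul_self_sqrt (hq0 i)
      have h4 : Real.sqrt (q i) ≠ 0 := (Real.sqrt_pos.2 h2).ne'
      calc _ = q i * (Real.sqrt (q i) * Real.sqrt (q i))⁻¹ * (U i k * U i l) := by
            rw [mul_inv]; ring
        _ = U i k * U i l := by rw [h3, mul_inv_cancel₀ hi, one_mul]
  · rw [smul_dotProduct, dotProduct_smul, smul_eq_mul, smul_eq_mul]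
    have h1 : U i ⬝ᵥ U i = d * q i := by
      rw [← hnorm i, dotProduct]
      simp only [sq]
    rw [h1]
    have h3 := Real.mul_self_sqrt (hq0 i)
    calc (Real.sqrt (q i))⁻¹ * ((Real.sqrt (q i))⁻¹ * (d * q i))
        = d * ((Real.sqrt (q i) * Real.sqrt (q i))⁻¹ * q i) := by rw [mul_inv]; ring
      _ = d * ((q i)⁻¹ * q i) := by rw [h3]
      _ ≤ d * 1 := mul_le_mul_of_nonneg_left inv_mul_le_one (by positivity)
      _ = d := mul_one _
  · have h1 : (2 : ℝ) * p ≤ r := by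
      have : (0 : ℝ) ≤ p := Nat.cast_nonneg p
      nlinarith
    exact_mod_cast h1

/-- The success probability of the attack, in terms of the number of sampled rows. -/
theorem IsAttackLaw.two_thirds_le {n d : ℕ} [NeZero n] {A : Matrix (Fin n) (Fin d) ℝ}
    (hd : 1 ≤ d) (hA : A.rank = d) {ε : ℝ} (hε : 0 < ε) {p r : ℕ} (hp : 12 * d ≤ 2 ^ p)
    (hr : 32 * ((p : ℝ) + 1) * d ≤ r) (hrε : 1536 * d ≤ r * ε) {b : Fin n → ℝ}
    (hb : b ∈ nonzeroBinary n) {μ : PMF (Fin n → ℝ)} (hμ : IsAttackLaw A r μ) :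
    2 / 3 ≤ μ.toOuterMeasure {xs | xs ∈ nonzeroBinary n ∧
      colDistSq A xs ≤ (1 + ε) * colDistSq A b} := by
  classical
  obtain ⟨P, ⟨U, s, V, hsvd, hP⟩, out, hout, rfl⟩ := hμ
  have hU := hsvd.left_orthonormal
  have hAN : A = U * (diagonal s * V.transpose) := by
    rw [← Matrix.mul_assoc]
    exact hsvd.eq_mul
  subst hAN
  have hr0 : 0 < r := by
    have h1 : (1 : ℝ) ≤ d := by exact_mod_cast hd
    have h2 : (0 : ℝ) ≤ p := Nat.cast_nonneg p
    have : (0 : ℝ) < r := by nlinarith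
    exact_mod_cast this
  set e := b - U *ᵥ (Uᵀ *ᵥ b) with he
  have hUe : Uᵀ *ᵥ e = 0 := by
    rw [he, mulVec_sub, mulVec_mulVec, hU, one_mulVec, sub_self]
  have hcol := colDistSq_eq_residual hU hA b
  have t1 := sum_prod_leverage_gram_tail hU hd hP hp hr
  have t2 := sum_prod_residual_tail hd hP hUe hε hr0 hrε
  set good₁ : (Fin r → Fin n) → Prop := fun idx => ∀ v : Fin d → ℝ, (r : ℝ) / 16 * (v ⬝ᵥ v) ≤
      ∑ j, (((Real.sqrt (P (idx j)).toReal)⁻¹ • U (idx j)) ⬝ᵥ v) ^ 2 with hg1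
  set good₂ : (Fin r → Fin n) → Prop := fun idx =>
    (∑ j, (((P (idx j)).toReal)⁻¹ * e (idx j)) • U (idx j)) ⬝ᵥ
      (∑ j, (((P (idx j)).toReal)⁻¹ * e (idx j)) • U (idx j))
      ≤ (r : ℝ) ^ 2 * ε / 256 * (e ⬝ᵥ e) with hg2
  refine le_trans ?_ (ofReal_sum_le_toOuterMeasure_map P out _
    (Finset.univ.filter fun idx => good₁ idx ∧ good₂ idx) fun idx hidx hne => ?_)
  · have hw : ∀ idx : Fin r → Fin n, 0 ≤ ∏ j, (P (idx j)).toReal := fun idx =>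
      Finset.prod_nonneg fun j _ => ENNReal.toReal_nonneg
    have h1 := Finset.sum_filter_add_sum_filter_not Finset.univ
      (fun idx => good₁ idx ∧ good₂ idx) fun idx : Fin r → Fin n => ∏ j, (P (idx j)).toReal
    rw [sum_prod_eq_one P.sum_toReal_eq_one] at h1
    -- Union bound: the two failure probabilities are at most `1 / 6` each.
    have h2 : ∑ idx with ¬ (good₁ idx ∧ good₂ idx), ∏ j, (P (idx j)).toReal
        ≤ ∑ idx with ¬ good₁ idx, ∏ j, (P (idx j)).toReal
          + ∑ idx with ¬ good₂ idx, ∏ j, (P (idx j)).toReal := by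
      rw [← Finset.sum_union_inter]
      refine le_trans (Finset.sum_le_sum_of_subset_of_nonneg ?_ fun idx _ _ => hw idx)
        (le_add_of_nonneg_right (Finset.sum_nonneg fun idx _ => hw idx))
      intro idx
      simp only [Finset.mem_filter, Finset.mem_union, Finset.mem_univ, true_and]
      tauto
    have h3 : (2 / 3 : ℝ) ≤ ∑ idx with good₁ idx ∧ good₂ idx, ∏ j, (P (idx j)).toReal := by
      linarith
    refine le_trans (le_of_eq ?_) (ENNReal.ofReal_le_ofReal h3)
    rw [ENNReal.ofReal_div_of_pos (by norm_num)]
    norm_num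
  · obtain ⟨-, hidx1, hidx2⟩ := Finset.mem_filter.1 hidx
    have hs := hout idx hne
    refine ⟨hs.mem_nonzeroBinary, hs.colDistSq_le_of_regression hb fun w hw => ?_⟩
    refine sqDist_le_of_sampled_leastSquares hU hA hr0 b hidx1 ?_ hw
    rw [hcol]
    exact hidx2

end Success

/-! ### A program logic for values and step counts. -/

namespace Prog

section Semantics

variable {α β σ : Type}

/-- `p` draws no samples, returns `v`, and takes at most `c` steps. -/
inductive Evaluates : Prog ℝ α → α → ℕ → Prop
  | ret (a : α) (c : ℕ) : Evaluates (ret a) a c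
  | tick {k : Prog ℝ α} {v : α} {c : ℕ} : Evaluates k v c → Evaluates (tick k) v (c + 1)
  | lit {q : ℚ} {k : ℝ → Prog ℝ α} {v : α} {c : ℕ} :
      Evaluates (k (q : ℝ)) v c → Evaluates (lit q k) v (c + 1)
  | arith {o : ArithOp} {x y : ℝ} {k : ℝ → Prog ℝ α} {v : α} {c : ℕ} :
      Evaluates (k (o.eval x y)) v c → Evaluates (arith o x y k) v (c + 1)
  | sqrt {x : ℝ} {k : ℝ → Prog ℝ α} {v : α} {c : ℕ} :
      Evaluates (k (Real.sqrt x)) v c → Evaluates (sqrt x k) v (c + 1)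
  -- The outcome is described by an equivalence instead of `decide`, so that it does not depend on a
  -- decidability instance.
  | less {x y : ℝ} {k : Bool → Prog ℝ α} {v : α} {c : ℕ} (b : Bool) (hb : b = true ↔ x < y) :
      Evaluates (k b) v c → Evaluates (less x y k) v (c + 1)

theorem Evaluates.mono {p : Prog ℝ α} {v : α} {c c' : ℕ} (h : Evaluates p v c) (hc : c ≤ c') :
    Evaluates p v c' := by
  induction h generalizing c' with
  | ret a c => exact .ret a c'
  | tick _ ih =>
    obtain ⟨c', rfl⟩ : ∃ e, c' = e + 1 := ⟨c' - 1, by omega⟩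
    exact .tick (ih (by omega))
  | lit _ ih =>
    obtain ⟨c', rfl⟩ : ∃ e, c' = e + 1 := ⟨c' - 1, by omega⟩
    exact .lit (ih (by omega))
  | arith _ ih =>
    obtain ⟨c', rfl⟩ : ∃ e, c' = e + 1 := ⟨c' - 1, by omega⟩
    exact .arith (ih (by omega))
  | sqrt _ ih =>
    obtain ⟨c', rfl⟩ : ∃ e, c' = e + 1 := ⟨c' - 1, by omega⟩
    exact .sqrt (ih (by omega))
  | less b hb _ ih =>
    obtain ⟨c', rfl⟩ : ∃ e, c' = e + 1 := ⟨c' - 1, by omega⟩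
    exact .less b hb (ih (by omega))

theorem Evaluates.bind {p : Prog ℝ α} {f : α → Prog ℝ β} {v : α} {w : β} {c c' : ℕ}
    (h : Evaluates p v c) (h' : Evaluates (f v) w c') : Evaluates (p >>= f) w (c + c') := by
  change Evaluates (Prog.bind p f) w (c + c')
  induction h with
  | ret a c => exact h'.mono (Nat.le_add_left _ _)
  | tick _ ih => rw [Nat.add_right_comm]; exact .tick (ih h')
  | lit _ ih => rw [Nat.add_right_comm]; exact .lit (ih h')
  | arith _ ih => rw [Nat.add_right_comm]; exact .arith (ih h')
  | sqrt _ ih => rw [Nat.add_right_comm]; exact .sqrt (ih h')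
  | less b hb _ ih => rw [Nat.add_right_comm]; exact .less b hb (ih h')

theorem Evaluates.law_eq {p : Prog ℝ α} {v : α} {c : ℕ} (h : Evaluates p v c) :
    p.law = PMF.pure v := by
  induction h with
  | ret a c => rfl
  | tick _ ih => exact ih
  | lit _ ih => exact ih
  | arith _ ih => exact ih
  | sqrt _ ih => exact ih
  | less b hb _ ih =>
    rw [law, ← ih]
    congr 2
    rw [Bool.eq_iff_iff, hb, decide_eq_true_iff]

theorem Evaluates.law_bind_eq {p : Prog ℝ α} {f : α → Prog ℝ β} {v : α} {c : ℕ}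
    (h : Evaluates p v c) : (p >>= f).law = (f v).law := by
  change (Prog.bind p f).law = _
  induction h with
  | ret a c => rfl
  | tick _ ih => exact ih
  | lit _ ih => exact ih
  | arith _ ih => exact ih
  | sqrt _ ih => exact ih
  | less b hb _ ih =>
    rw [Prog.bind, law, ← ih]
    congr 3
    rw [Bool.eq_iff_iff, hb, decide_eq_true_iff]

theorem Evaluates.cost_bind_le {p : Prog ℝ α} {f : α → Prog ℝ β} {v : α} {c : ℕ}
    (h : Evaluates p v c) : (p >>= f).cost ≤ c + (f v).cost := by
  change (Prog.bind p f).cost ≤ _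
  induction h with
  | ret a c => exact Nat.le_add_left _ _
  | tick _ ih => rw [Prog.bind, cost]; omega
  | lit _ ih => rw [Prog.bind, cost]; omega
  | arith _ ih => rw [Prog.bind, cost]; omega
  | sqrt _ ih => rw [Prog.bind, cost]; omega
  | @less x y k v c b hb _ ih =>
    have hbd : ∀ inst : Decidable (x < y), @decide (x < y) inst = b := fun inst => by
      rw [Bool.eq_iff_iff, hb, decide_eq_true_iff]
    rw [Prog.bind, cost, hbd]
    omega

theorem Evaluates.cost_le {p : Prog ℝ α} {v : α} {c : ℕ} (h : Evaluates p v c) : p.cost ≤ c := by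
  induction h with
  | ret a c => exact Nat.zero_le _
  | tick _ ih => rw [cost]; omega
  | lit _ ih => rw [cost]; omega
  | arith _ ih => rw [cost]; omega
  | sqrt _ ih => rw [cost]; omega
  | @less x y k v c b hb _ ih =>
    have hbd : ∀ inst : Decidable (x < y), @decide (x < y) inst = b := fun inst => by
      rw [Bool.eq_iff_iff, hb, decide_eq_true_iff]
    rw [cost, hbd]
    omega

theorem law_bind (p : Prog ℝ α) (f : α → Prog ℝ β) :
    (p >>= f).law = p.law.bind fun a => (f a).law := by
  change (Prog.bind p f).law = _
  induction p with
  | ret a => exact (PMF.pure_bind a fun a => (f a).law).symm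
  | tick k ih => exact ih
  | lit q k ih => exact ih _
  | arith o x y k ih => exact ih _
  | sqrt x k ih => exact ih _
  | less x y k ih => exact ih _
  | sample p k ih =>
    rw [Prog.bind, law, law, PMF.bind_bind]
    congr 1
    ext1 i
    exact ih i

theorem cost_bind_le (p : Prog ℝ α) (f : α → Prog ℝ β) {c : ℕ} (hf : ∀ a, (f a).cost ≤ c) :
    (p >>= f).cost ≤ p.cost + c := by
  change (Prog.bind p f).cost ≤ _
  induction p with
  | ret a => exact (hf a).trans (Nat.le_add_left _ _)
  | tick k ih => rw [Prog.bind, cost, cost]; omega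
  | lit q k ih => rw [Prog.bind, cost, cost]; have := ih q; omega
  | arith o x y k ih => rw [Prog.bind, cost, cost]; have := ih (o.eval x y); omega
  | sqrt x k ih => rw [Prog.bind, cost, cost]; have := ih (Real.sqrt x); omega
  | less x y k ih =>
    rw [Prog.bind, cost, cost, add_assoc]
    exact Nat.add_le_add_left (ih _) _
  | sample p k ih =>
    rw [Prog.bind, cost, cost, add_assoc]
    refine Nat.add_le_add_left (Finset.sup_le fun i _ => (ih i).trans ?_) _
    exact Nat.add_le_add_right
      (Finset.le_sup (f := fun i => (k i).cost) (Finset.mem_univ i)) _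

/-- `p` draws no samples, takes at most `c` steps, and its result satisfies `Q`. -/
def Runs (p : Prog ℝ α) (Q : α → Prop) (c : ℕ) : Prop :=
  ∃ v, Evaluates p v c ∧ Q v

theorem Evaluates.runs {p : Prog ℝ α} {v : α} {c : ℕ} (h : Evaluates p v c) :
    Runs p (· = v) c :=
  ⟨v, h, rfl⟩

theorem Runs.mono {p : Prog ℝ α} {Q Q' : α → Prop} {c c' : ℕ} (h : Runs p Q c)
    (hc : c ≤ c') (hQ : ∀ v, Q v → Q' v) : Runs p Q' c' :=
  let ⟨v, hv, hq⟩ := h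
  ⟨v, hv.mono hc, hQ v hq⟩

theorem Runs.bind {p : Prog ℝ α} {f : α → Prog ℝ β} {Q : α → Prop} {Q' : β → Prop} {c c' : ℕ}
    (h : Runs p Q c) (h' : ∀ v, Q v → Runs (f v) Q' c') : Runs (p >>= f) Q' (c + c') :=
  let ⟨v, hv, hq⟩ := h
  let ⟨w, hw, hq'⟩ := h' v hq
  ⟨w, hv.bind hw, hq'⟩

theorem Runs.bind_eq {p : Prog ℝ α} {f : α → Prog ℝ β} {v : α} {Q' : β → Prop} {c c' : ℕ}
    (h : Runs p (· = v) c) (h' : Runs (f v) Q' c') : Runs (p >>= f) Q' (c + c') :=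
  h.bind fun _ hw => hw ▸ h'

theorem runs_ret {a : α} {Q : α → Prop} (h : Q a) : Runs (ret a) Q 0 := ⟨a, .ret a 0, h⟩

theorem runs_step : Runs step (fun _ => True) 1 := ⟨(), .tick (.ret _ _), trivial⟩

theorem runs_const (q : ℚ) : Runs (const q) (· = (q : ℝ)) 1 := ⟨_, .lit (.ret _ _), rfl⟩

theorem runs_plus (x y : ℝ) : Runs (plus x y) (· = x + y) 1 := ⟨_, .arith (.ret _ _), rfl⟩

theorem runs_minus (x y : ℝ) : Runs (minus x y) (· = x - y) 1 := ⟨_, .arith (.ret _ _), rfl⟩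

theorem runs_times (x y : ℝ) : Runs (times x y) (· = x * y) 1 := ⟨_, .arith (.ret _ _), rfl⟩

theorem runs_divide (x y : ℝ) : Runs (divide x y) (· = x / y) 1 := ⟨_, .arith (.ret _ _), rfl⟩

theorem runs_root (x : ℝ) : Runs (root x) (· = Real.sqrt x) 1 := ⟨_, .sqrt (.ret _ _), rfl⟩

theorem runs_lt (x y : ℝ) : Runs (lt x y) (fun b => b = true ↔ x < y) 1 := by
  classical
  exact ⟨decide (x < y), .less _ decide_eq_true_iff (.ret _ _), decide_eq_true_iff⟩

theorem runs_loop {m : ℕ} {f : Fin m → σ → Prog ℝ σ} {s : σ} (I : ℕ → σ → Prop) {c : ℕ}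
    (h0 : I 0 s) (hf : ∀ (i : Fin m) s, I i s → Runs (f i s) (I (i + 1)) c) :
    Runs (loop m f s) (I m) (m * (c + 1)) := by
  induction m with
  | zero => exact (runs_ret h0).mono (Nat.zero_le _) fun _ h => h
  | succ m ih =>
    have h1 := ih (f := fun i => f i.castSucc) fun i s hs => hf i.castSucc s hs
    refine Runs.mono (h1.bind fun s' hs' => runs_step.bind fun _ _ => hf (Fin.last m) s' hs')
      (le_of_eq ?_) fun _ h => h
    ring

/-- Serves all accumulating loops: inner products with `σ = ℝ`, regression with vectors, and
Gram–Schmidt with pairs of vectors. -/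
theorem runs_loop_add [AddCommMonoid σ] {m : ℕ} {f : Fin m → σ → Prog ℝ σ} (a : Fin m → σ)
    (s : σ) {c : ℕ} (hf : ∀ i s, Runs (f i s) (· = s + a i) c) :
    Runs (loop m f s) (· = s + ∑ i, a i) (m * (c + 1)) := by
  induction m with
  | zero => exact (runs_ret (by simp)).mono (Nat.zero_le _) fun _ h => h
  | succ m ih =>
    have h1 := ih (f := fun i => f i.castSucc) (fun i => a i.castSucc)
      fun i s => hf i.castSucc s
    refine Runs.mono (h1.bind_eq (runs_step.bind fun _ _ => hf (Fin.last m) _))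
      (le_of_eq (by ring)) fun v hv => ?_
    rw [hv, Fin.sum_univ_castSucc, add_assoc]

theorem runs_tabulate {m : ℕ} {f : Fin m → Prog ℝ β} {Q : Fin m → β → Prop} {c : ℕ}
    (hf : ∀ i, Runs (f i) (Q i) c) :
    Runs (tabulate m f) (fun v => ∀ i, Q i (v i)) (m * (c + 1)) := by
  induction m with
  | zero => exact (runs_ret fun i => i.elim0).mono (Nat.zero_le _) fun _ h => h
  | succ m ih =>
    have h1 := ih (f := fun i => f i.castSucc) fun i => hf i.castSucc
    refine Runs.mono (h1.bind fun v hv => (hf (Fin.last m)).bind fun a ha =>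
      runs_step.bind fun _ _ => runs_ret (Q := fun v : Fin (m + 1) → β => ∀ i, Q i (v i)) ?_)
      (le_of_eq (by ring)) fun _ h => h
    intro i
    induction i using Fin.lastCases with
    | last => simpa using ha
    | cast i => simpa using hv i

theorem runs_tabulate_eq {m : ℕ} {f : Fin m → Prog ℝ β} {g : Fin m → β} {c : ℕ}
    (hf : ∀ i, Runs (f i) (· = g i) c) : Runs (tabulate m f) (· = g) (m * (c + 1)) :=
  (runs_tabulate hf).mono le_rfl fun _ hv => funext hv

end Semantics

/-! ### Correctness and cost of the linear algebra routines. -/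

section LinearAlgebra

open Matrix

theorem runs_dot {m : ℕ} (u v : Fin m → ℝ) : Runs (dot u v) (· = u ⬝ᵥ v) (3 * m + 1) := by
  have h1 : ∀ z, Runs (loop m (fun i s => do
      let t ← times (u i) (v i)
      plus s t) z) (· = z + ∑ i, u i * v i) (m * (1 + 1 + 1)) := fun z =>
    runs_loop_add (fun i => u i * v i) z fun i s =>
      (runs_times _ _).bind_eq (runs_plus _ _)
  refine Runs.mono ((runs_const 0).bind_eq (h1 _)) (by omega) fun w hw => ?_
  rw [hw, Rat.cast_zero, zero_add, dotProduct]

theorem runs_matVec {n d : ℕ} (A : Matrix (Fin n) (Fin d) ℝ) (w : Fin d → ℝ) :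
    Runs (matVec A w) (· = A *ᵥ w) (n * (3 * d + 2)) :=
  runs_tabulate_eq fun i => runs_dot (A i) w

theorem runs_plusMul {m : ℕ} (u : Fin m → ℝ) (c : ℝ) (v : Fin m → ℝ) :
    Runs (plusMul u c v) (· = u + c • v) (m * 3) :=
  runs_tabulate_eq fun _ => (runs_times _ _).bind_eq (runs_plus _ _)

theorem runs_minusMul {m : ℕ} (u : Fin m → ℝ) (c : ℝ) (v : Fin m → ℝ) :
    Runs (minusMul u c v) (· = u - c • v) (m * 3) :=
  runs_tabulate_eq fun _ => (runs_times _ _).bind_eq (runs_minus _ _)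

theorem runs_coef {m : ℕ} (b q : Fin m → ℝ) :
    Runs (coef b q) (· = (b ⬝ᵥ q) / (q ⬝ᵥ q)) (6 * m + 5) := by
  refine Runs.mono ((runs_dot q q).bind_eq ((runs_dot b q).bind_eq ((runs_const 0).bind_eq
    ((runs_lt _ _).bind (Q' := (· = (b ⬝ᵥ q) / (q ⬝ᵥ q))) (c' := 1) fun t ht => ?_))))
    (by omega) fun _ h => h
  cases t with
  | true => exact runs_divide _ _
  -- Here `q = 0`, and the `0` returned by the program agrees with the convention `x / 0 = 0`.
  | false =>
    refine (runs_ret ?_).mono (Nat.zero_le _) fun _ h => h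
    have h1 : ¬ ((0 : ℚ) : ℝ) < q ⬝ᵥ q := by simpa using ht
    have h2 := real_dotProduct_self_nonneg q
    rw [Rat.cast_zero] at h1 ⊢
    rw [le_antisymm (not_lt.1 h1) h2, div_zero]

/-- The projection coefficient in Gram–Schmidt orthogonalization. -/
theorem coef_mul_dotProduct_self {m : ℕ} (b q : Fin m → ℝ) :
    (b ⬝ᵥ q) / (q ⬝ᵥ q) * (q ⬝ᵥ q) = b ⬝ᵥ q := by
  by_cases h : q ⬝ᵥ q = 0
  · rw [dotProduct_self_eq_zero.1 h]
    simp
  · exact div_mul_cancel₀ _ h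

/-- The residual of the projection onto orthogonal vectors is orthogonal to them. -/
theorem residual_dotProduct_eq_zero {m d : ℕ} {q : Fin d → Fin m → ℝ}
    (hq : ∀ j k, j ≠ k → q j ⬝ᵥ q k = 0) (b : Fin m → ℝ) (l : Fin d) :
    (b - ∑ k, ((b ⬝ᵥ q k) / (q k ⬝ᵥ q k)) • q k) ⬝ᵥ q l = 0 := by
  rw [sub_dotProduct, sum_dotProduct, Finset.sum_eq_single l]
  · rw [smul_dotProduct, smul_eq_mul, coef_mul_dotProduct_self, sub_self]
  · intro k _ hk
    rw [smul_dotProduct, hq k l hk, smul_zero]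
  · simp

/-- No independence is assumed, so vectors of the result may vanish. Completeness is stated by
duality, as `y` orthogonal to all results being orthogonal to all inputs; this is the form in which
the normal equations use it. -/
theorem runs_gramSchmidt {m D d : ℕ} (B : Fin d → Fin m → ℝ) (E : Fin d → Fin D → ℝ)
    (M : Matrix (Fin m) (Fin D) ℝ) (hM : ∀ j, B j = M *ᵥ E j) :
    Runs (gramSchmidt d B E) (fun Q =>
      (∀ j k, j ≠ k → (Q j).1 ⬝ᵥ (Q k).1 = 0) ∧
      (∀ j, (Q j).1 = M *ᵥ (Q j).2) ∧
      ∀ y, (∀ k, (Q k).1 ⬝ᵥ y = 0) → ∀ j, B j ⬝ᵥ y = 0)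
      (d * (d * (9 * m + 3 * D + 6) + 1)) := by
  induction d with
  | zero =>
    exact (runs_ret ⟨fun j => j.elim0, fun j => j.elim0, fun _ _ j => j.elim0⟩).mono
      (Nat.zero_le _) fun _ h => h
  | succ d ih =>
    refine Runs.mono ((ih (fun j => B j.castSucc) (fun j => E j.castSucc)
      fun j => hM j.castSucc).bind
      (c' := d * (9 * m + 3 * D + 6) + 1) fun Q hQ => ?_) ?_ fun _ h => h
    · obtain ⟨horth, hcomb, hcompl⟩ := hQ
      set b := B (Fin.last d) with hb
      set c : Fin d → ℝ := fun k => (b ⬝ᵥ (Q k).1) / ((Q k).1 ⬝ᵥ (Q k).1) with hc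
      -- The coefficients are computed from the original vector `b` and not from the running
      -- residual, so every round adds a term independent of the state.
      refine Runs.mono ((runs_loop_add (c := 9 * m + 3 * D + 5)
        (fun k => (-(c k • (Q k).1), -(c k • (Q k).2))) (b, E (Fin.last d))
        fun k s => ?_).bind_eq (runs_step.bind fun _ _ => runs_ret ?_))
        (le_of_eq (by ring)) fun _ h => h
      · refine Runs.mono ((runs_coef _ _).bind_eq ((runs_minusMul _ _ _).bind_eq
          ((runs_minusMul _ _ _).bind_eq (runs_ret ?_)))) (by omega) fun _ h => h
        exact Prod.ext (sub_eq_add_neg _ _) (sub_eq_add_neg _ _)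
      · have hq : ((b, E (Fin.last d)) + ∑ k, (-(c k • (Q k).1), -(c k • (Q k).2)))
            = (b - ∑ k, c k • (Q k).1, E (Fin.last d) - ∑ k, c k • (Q k).2) := by
          refine Prod.ext ?_ ?_
          · rw [Prod.fst_add, Prod.fst_sum, Finset.sum_neg_distrib, sub_eq_add_neg]
          · rw [Prod.snd_add, Prod.snd_sum, Finset.sum_neg_distrib]
            exact (sub_eq_add_neg _ _).symm
        rw [hq]
        have hres := residual_dotProduct_eq_zero horth b
        refine ⟨fun j k hjk => ?_, fun j => ?_, fun y hy j => ?_⟩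
        · induction j using Fin.lastCases with
          | last =>
            induction k using Fin.lastCases with
            | last => exact absurd rfl hjk
            | cast k =>
              simp only [Fin.snoc_last, Fin.snoc_castSucc]
              exact hres k
          | cast j =>
            induction k using Fin.lastCases with
            | last =>
              simp only [Fin.snoc_last, Fin.snoc_castSucc]
              rw [dotProduct_comm]
              exact hres j
            | cast k =>
              simp only [Fin.snoc_castSucc]
              exact horth j k fun h => hjk (h ▸ rfl)
        · induction j using Fin.lastCases with
          | last =>
            simp only [Fin.snoc_last]
            rw [mulVec_sub, mulVec_sum, hb, hM]
            congr 1
            exact Finset.sum_congr rfl fun k _ => by rw [mulVec_smul, hcomb]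
          | cast j =>
            simp only [Fin.snoc_castSucc]
            exact hcomb j
        · have hy1 : ∀ k, (Q k).1 ⬝ᵥ y = 0 := fun k => by
            simpa only [Fin.snoc_castSucc] using hy k.castSucc
          have hy2 : (b - ∑ k, c k • (Q k).1) ⬝ᵥ y = 0 := by
            simpa only [Fin.snoc_last] using hy (Fin.last d)
          induction j using Fin.lastCases with
          | last =>
            rw [sub_dotProduct, sum_dotProduct, Finset.sum_eq_zero, sub_zero] at hy2
            · exact hy2
            · intro k _
              rw [smul_dotProduct, hy1, smul_zero]
          | cast j => exact hcompl y hy1 j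
    · nlinarith [Nat.zero_le (d * (9 * m + 3 * D + 6)), Nat.zero_le (9 * m + 3 * D + 6)]

/-- The vectors `(Q j).1 = A (Q j).2` are an orthogonal generating system of the column space. -/
structure IsFactorization {m d : ℕ} (A : Matrix (Fin m) (Fin d) ℝ)
    (Q : Fin d → (Fin m → ℝ) × (Fin d → ℝ)) : Prop where
  orthogonal : ∀ j k, j ≠ k → (Q j).1 ⬝ᵥ (Q k).1 = 0
  eq_mulVec : ∀ j, (Q j).1 = A *ᵥ (Q j).2
  complete : ∀ y, (∀ k, (Q k).1 ⬝ᵥ y = 0) → ∀ u, (A *ᵥ u) ⬝ᵥ y = 0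

theorem runs_factorize {m d : ℕ} (hd : 1 ≤ d) (A : Matrix (Fin m) (Fin d) ℝ) :
    Runs (factorize A) (IsFactorization A) (14 * (d * d * (m + d))) := by
  have hE : Runs (tabulate d fun i : Fin d => tabulate d fun j : Fin d =>
      if i = j then const 1 else const 0)
      (· = fun i j => if i = j then (1 : ℝ) else 0) (d * (d * (1 + 1) + 1)) := by
    refine runs_tabulate_eq fun i => runs_tabulate_eq fun j => ?_
    split_ifs
    · simpa using runs_const 1
    · simpa using runs_const 0
  have hB : Runs (tabulate (R := ℝ) d fun j => tabulate m fun i => ret (A i j))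
      (· = fun j i => A i j) (d * (m * (0 + 1) + 1)) :=
    runs_tabulate_eq fun j => runs_tabulate_eq fun i => runs_ret rfl
  refine Runs.mono (hE.bind_eq (hB.bind_eq (runs_gramSchmidt _ _ A fun j => ?_))) ?_ fun Q hQ => ?_
  · ext i
    simp [mulVec, dotProduct]
  · have h1 : d ≤ d * d := Nat.le_mul_self d
    have h2 : d * m ≤ d * d * m := Nat.mul_le_mul_right m h1
    have h3 : d * d ≤ d * d * d := Nat.le_mul_of_pos_right _ hd
    nlinarith
  · refine ⟨hQ.1, hQ.2.1, fun y hy u => ?_⟩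
    have h1 := hQ.2.2 y hy
    rw [dotProduct_comm, dotProduct_mulVec, ← mulVec_transpose]
    have h2 : Aᵀ *ᵥ y = 0 := funext fun j => h1 j
    rw [h2, zero_dotProduct]

/-- The residual of the projection is orthogonal to all vectors of the factorization, hence by
completeness to the column space: these are the normal equations. Rank is irrelevant, as the sampled
matrix requires. -/
theorem runs_regress {m d : ℕ} {A : Matrix (Fin m) (Fin d) ℝ}
    {Q : Fin d → (Fin m → ℝ) × (Fin d → ℝ)} (hQ : IsFactorization A Q) (b : Fin m → ℝ) :
    Runs (regress Q b) (IsLeastSquares A b) (d * (6 * m + 3 * d + 8)) := by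
  have h0 : Runs (tabulate d fun _ => const 0) (· = (0 : Fin d → ℝ)) (d * 2) :=
    runs_tabulate_eq fun _ => by simpa using runs_const 0
  refine Runs.mono (h0.bind_eq (runs_loop_add (c := 6 * m + 3 * d + 5)
    (fun k => ((b ⬝ᵥ (Q k).1) / ((Q k).1 ⬝ᵥ (Q k).1)) • (Q k).2) 0 fun k s => ?_))
    (le_of_eq (by ring)) fun w hw => ?_
  · exact Runs.mono ((runs_coef _ _).bind_eq (runs_plusMul _ _ _)) (by omega) fun _ h => h
  · rw [isLeastSquares_iff]
    have h1 : A *ᵥ w = ∑ k, ((b ⬝ᵥ (Q k).1) / ((Q k).1 ⬝ᵥ (Q k).1)) • (Q k).1 := by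
      rw [hw, zero_add, mulVec_sum]
      exact Finset.sum_congr rfl fun k _ => by rw [mulVec_smul, ← hQ.eq_mulVec]
    refine hQ.complete _ fun k => ?_
    rw [h1, dotProduct_comm]
    exact residual_dotProduct_eq_zero hQ.orthogonal b k

theorem runs_spanDist {n d : ℕ} (hd : 1 ≤ d) (hdn : d ≤ n) {A : Matrix (Fin n) (Fin d) ℝ}
    {Q : Fin d → (Fin n → ℝ) × (Fin d → ℝ)} (hQ : IsFactorization A Q) (x : Fin n → ℝ) :
    Runs (spanDist A Q x) (· = colDistSq A x) (28 * (d * n)) := by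
  refine Runs.mono ((runs_regress hQ x).bind fun w hw => (runs_matVec A w).bind_eq
    ((runs_tabulate_eq fun i => runs_minus _ _).bind_eq
      ((runs_dot _ _).mono (Q' := (· = colDistSq A x)) le_rfl fun v hv => ?_))) ?_ fun _ h => h
  · rw [hv, ← hw.sqDist_eq, sqDist_eq_dotProduct]
    rfl
  · have h1 : d * d ≤ d * n := Nat.mul_le_mul_left d hdn
    have h2 : n ≤ d * n := Nat.le_mul_of_pos_left n hd
    nlinarith

end LinearAlgebra

end Prog

/-! ### Leverage scores from Gram–Schmidt. -/

section SingularValues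

open Matrix

/-- The normalized vectors of a factorization, as columns. -/
noncomputable def orthonormalFactor {m d : ℕ} (Q : Fin d → (Fin m → ℝ) × (Fin d → ℝ)) :
    Matrix (Fin m) (Fin d) ℝ :=
  Matrix.of fun i j => (Q j).1 i / Real.sqrt ((Q j).1 ⬝ᵥ (Q j).1)

/-- The residual of a column of `A` is orthogonal to the factorization, hence to that column, hence
to itself; so it vanishes and `A = W T`. Rank `d` then forces every column of `W` to be nonzero, and
normalization is legitimate. -/
theorem Prog.IsFactorization.exists_orthonormal {n d : ℕ} {A : Matrix (Fin n) (Fin d) ℝ}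
    {Q : Fin d → (Fin n → ℝ) × (Fin d → ℝ)} (hQ : IsFactorization A Q) (hA : A.rank = d) :
    (orthonormalFactor Q)ᵀ * orthonormalFactor Q = 1 ∧
      ∃ N : Matrix (Fin d) (Fin d) ℝ, A = orthonormalFactor Q * N := by
  set l : Fin d → ℝ := fun k => (Q k).1 ⬝ᵥ (Q k).1 with hl
  set W : Matrix (Fin n) (Fin d) ℝ := Matrix.of fun i k => (Q k).1 i with hW
  set T : Matrix (Fin d) (Fin d) ℝ := Matrix.of fun k j => (A.col j ⬝ᵥ (Q k).1) / l k with hT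
  have hAWT : A = W * T := by
    ext i j
    set y := A.col j - ∑ k, ((A.col j ⬝ᵥ (Q k).1) / l k) • (Q k).1 with hy
    have h1 : ∀ k, (Q k).1 ⬝ᵥ y = 0 := fun k => by
      rw [dotProduct_comm]
      exact residual_dotProduct_eq_zero hQ.orthogonal (A.col j) k
    have h2 : A.col j ⬝ᵥ y = 0 := by
      have := hQ.complete y h1 (Pi.single j 1)
      rwa [mulVec_single_one] at this
    have h3 : y ⬝ᵥ y = 0 := by
      nth_rewrite 1 [hy]
      rw [sub_dotProduct, h2, sum_dotProduct, Finset.sum_eq_zero, sub_zero]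
      intro k _
      rw [smul_dotProduct, h1, smul_zero]
    have h4 := congrFun (sub_eq_zero.1 (hy.symm.trans (dotProduct_self_eq_zero.1 h3))) i
    rw [Matrix.mul_apply]
    refine h4.trans ?_
    rw [Finset.sum_apply]
    exact Finset.sum_congr rfl fun k _ => mul_comm _ _
  have hWW : Wᵀ * W = diagonal l := by
    ext j k
    rw [Matrix.mul_apply, diagonal_apply]
    split_ifs with h
    · subst h; rfl
    · exact hQ.orthogonal j k h
  have hWr : W.rank = d := le_antisymm (by simpa using W.rank_le_width) (by
    have := rank_mul_le_left W T
    rwa [← hAWT, hA] at this)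
  have hlpos : ∀ k, 0 < l k := by
    intro k
    have h1 : ((1 : Matrix (Fin d) (Fin d) ℝ) * diagonal l).rank = d := by
      rw [Matrix.one_mul, ← hWW, rank_transpose_mul_self, hWr]
    obtain ⟨w, hw⟩ := exists_mulVec_eq_of_rank_mul h1 (Pi.single k 1)
    have h2 := congrFun hw k
    rw [mulVec_diagonal, Pi.single_eq_same] at h2
    refine lt_of_le_of_ne (real_dotProduct_self_nonneg _) fun h3 => ?_
    rw [← h3, zero_mul] at h2
    exact zero_ne_one h2
  have hs : ∀ k, Real.sqrt (l k) ≠ 0 := fun k => (Real.sqrt_pos.2 (hlpos k)).ne'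
  have hU : orthonormalFactor Q = W * diagonal fun k => (Real.sqrt (l k))⁻¹ := by
    ext i k
    rw [mul_diagonal]
    exact div_eq_mul_inv _ _
  refine ⟨?_, diagonal (fun k => Real.sqrt (l k)) * T, ?_⟩
  · rw [hU, transpose_mul, diagonal_transpose, Matrix.mul_assoc, ← Matrix.mul_assoc Wᵀ, hWW,
      diagonal_mul_diagonal, diagonal_mul_diagonal, ← diagonal_one]
    congr 1
    ext k
    have h1 := Real.mul_self_sqrt (hlpos k).le
    nth_rewrite 2 [← h1]
    field_simp [hs k]
  · rw [hU, Matrix.mul_assoc, ← Matrix.mul_assoc (diagonal _), diagonal_mul_diagonal]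
    have : (fun i => (Real.sqrt (l i))⁻¹ * Real.sqrt (l i)) = fun _ => (1 : ℝ) :=
      funext fun i => inv_mul_cancel₀ (hs i)
    rw [this, diagonal_one, Matrix.one_mul, ← hAWT]

/-- The leverage scores do not depend on the orthonormal basis of the column space. -/
theorem exists_isThinSVD {n d : ℕ} {U : Matrix (Fin n) (Fin d) ℝ} (hU : Uᵀ * U = 1)
    {N : Matrix (Fin d) (Fin d) ℝ} (h : (U * N).rank = d) :
    ∃ U' s V, IsThinSVD (U * N) U' s V ∧ ∀ i, ∑ j, U' i j ^ 2 = ∑ j, U i j ^ 2 := by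
  have hN : Function.Injective N.mulVec := by
    have h1 : Function.Surjective N.mulVecLin := fun z => by
      simpa using exists_mulVec_eq_of_rank_mul h z
    exact (LinearMap.injective_iff_surjective (f := N.mulVecLin)).2 h1
  have hpd : (Nᵀ * N).PosDef := by
    refine PosDef.of_dotProduct_mulVec_pos ?_ fun v hv => ?_
    · rw [IsHermitian, conjTranspose_eq_transpose_of_trivial, transpose_mul, transpose_transpose]
    · rw [star_trivial, ← mulVec_mulVec, dotProduct_mulVec, ← mulVec_transpose,
        transpose_transpose]
      refine lt_of_le_of_ne (real_dotProduct_self_nonneg _) fun h0 => hv (hN ?_)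
      rw [dotProduct_self_eq_zero.1 h0.symm, mulVec_zero]
  obtain ⟨O, l, hO, hO', hl, hG⟩ := hpd.exists_orthogonal_diagonal
  have hs : ∀ k, Real.sqrt (l k) ≠ 0 := fun k => (Real.sqrt_pos.2 (hl k)).ne'
  set D := diagonal fun k => (Real.sqrt (l k))⁻¹ with hD
  -- With `Nᵀ N = O diag(l) Oᵀ`, the matrix `K = N O diag(l)^{-1/2}` is orthogonal. Then `U K`
  -- consists of left singular vectors, and `K Kᵀ = 1` preserves the row norms of `U`.
  set K := N * O * D with hK
  have hKK : Kᵀ * K = 1 := by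
    calc Kᵀ * K = D * (Oᵀ * (Nᵀ * N) * O) * D := by
          rw [hK, transpose_mul, transpose_mul, hD, diagonal_transpose]
          simp only [Matrix.mul_assoc]
      _ = D * ((Oᵀ * O) * diagonal l * (Oᵀ * O)) * D := by
          rw [hG]
          simp only [Matrix.mul_assoc]
      _ = 1 := by
          rw [hO, Matrix.one_mul, Matrix.mul_one, hD, diagonal_mul_diagonal,
            diagonal_mul_diagonal, ← diagonal_one]
          congr 1
          ext k
          have h1 := Real.mul_self_sqrt (hl k).le
          nth_rewrite 2 [← h1]
          field_simp [hs k]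
  refine ⟨U * K, fun k => Real.sqrt (l k), O, ⟨?_, hO, fun k => Real.sqrt_nonneg _, ?_⟩,
    fun i => ?_⟩
  · rw [transpose_mul, Matrix.mul_assoc, ← Matrix.mul_assoc Uᵀ, hU, Matrix.one_mul, hKK]
  · have h1 : D * diagonal (fun k => Real.sqrt (l k)) = 1 := by
      rw [hD, diagonal_mul_diagonal, ← diagonal_one]
      congr 1
      exact funext fun k => inv_mul_cancel₀ (hs k)
    change U * N = U * K * diagonal (fun k => Real.sqrt (l k)) * Oᵀ
    calc U * N = U * N * (O * (D * diagonal fun k => Real.sqrt (l k)) * Oᵀ) := by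
          rw [h1, Matrix.mul_one, hO', Matrix.mul_one]
      _ = _ := by
          rw [hK]
          simp only [Matrix.mul_assoc]
  · have h1 : ∀ M : Matrix (Fin n) (Fin d) ℝ, ∑ j, M i j ^ 2 = (M * Mᵀ) i i := fun M => by
      simp only [Matrix.mul_apply, transpose_apply, sq]
    rw [h1, h1, transpose_mul, Matrix.mul_assoc, ← Matrix.mul_assoc K, mul_eq_one_comm.1 hKK,
      Matrix.one_mul]

theorem draw_apply {n : ℕ} [NeZero n] {p : Fin n → ℝ} (h0 : ∀ i, 0 ≤ p i) (h1 : ∑ i, p i = 1)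
    (i : Fin n) : draw p i = ENNReal.ofReal (p i) := by
  have h : ∑ i, ENNReal.ofReal (p i) = 1 ∧ ∀ i, 0 ≤ p i := by
    refine ⟨?_, h0⟩
    rw [← ENNReal.ofReal_sum_of_nonneg fun i _ => h0 i, h1, ENNReal.ofReal_one]
  rw [draw, dif_pos h, PMF.ofFintype_apply]

/-- The machine never computes a singular value decomposition. The scores from any orthonormal basis
of the column space sum to `1`, since the `d` columns have unit norm, and they agree with those of
some decomposition. -/
theorem draw_leverage {n d : ℕ} [NeZero n] (hd : 1 ≤ d) {A U : Matrix (Fin n) (Fin d) ℝ}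
    (hA : A.rank = d) (hU : Uᵀ * U = 1) 
    (hN : ∃ N : Matrix (Fin d) (Fin d) ℝ, A = U * N) :
    (∀ i, (draw (fun i => (∑ j, U i j ^ 2) / (d : ℝ)) i).toReal = (∑ j, U i j ^ 2) / d) ∧
      IsLeverageDist A (draw fun i => (∑ j, U i j ^ 2) / (d : ℝ)) := by
  obtain ⟨N, rfl⟩ := hN
  have hdR : (0 : ℝ) < d := by exact_mod_cast hd
  have h0 : ∀ i, 0 ≤ (∑ j, U i j ^ 2) / (d : ℝ) := fun i =>
    div_nonneg (Finset.sum_nonneg fun _ _ => sq_nonneg _) hdR.le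
  have h1 : ∑ i, (∑ j, U i j ^ 2) / (d : ℝ) = 1 := by
    rw [← Finset.sum_div, Finset.sum_comm, div_eq_one_iff_eq hdR.ne']
    have : ∀ j, ∑ i, U i j ^ 2 = 1 := fun j => by
      have := congrFun (congrFun hU j) j
      rw [Matrix.mul_apply, one_apply_eq] at this
      simpa only [transpose_apply, sq] using this
    simp [this]
  have h2 : ∀ i, (draw (fun i => (∑ j, U i j ^ 2) / (d : ℝ)) i).toReal
      = (∑ j, U i j ^ 2) / d := fun i => by
    rw [draw_apply h0 h1, ENNReal.toReal_ofReal (h0 i)]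
  refine ⟨h2, ?_⟩
  obtain ⟨U', s, V, hsvd, hrow⟩ := exists_isThinSVD hU hA
  exact ⟨U', s, V, hsvd, fun i => by rw [h2, hrow]⟩

end SingularValues

/-! ### Programs that draw independent samples. -/

namespace Prog

section Sampling

theorem law_tabulate_pick {n : ℕ} [NeZero n] (p : Fin n → ℝ) (r : ℕ) :
    (tabulate r fun _ => pick p).law = iidLaw (draw p) r := by
  induction r with
  | zero =>
    ext idx
    have h1 : idx = Fin.elim0 := Subsingleton.elim _ _
    rw [iidLaw, PMF.ofFintype_apply]
    change PMF.pure _ idx = _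
    rw [h1, PMF.pure_apply_self]
    rfl
  | succ r ih =>
    have h1 : (tabulate (r + 1) fun _ => pick p).law
        = (iidLaw (draw p) r).bind fun v => (draw p).bind fun a =>
          PMF.pure (Fin.snoc (α := fun _ => Fin n) v a) := by
      rw [← ih]
      change ((tabulate r fun _ => pick p) >>= fun v => pick p >>= fun a => step >>= fun _ =>
        ret (Fin.snoc (α := fun _ => Fin n) v a)).law = _
      rw [law_bind]
      rfl
    rw [h1]
    ext idx
    rw [PMF.bind_apply, tsum_fintype, Finset.sum_eq_single (Fin.init idx), PMF.bind_apply,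
      tsum_fintype, Finset.sum_eq_single (idx (Fin.last r)), Fin.snoc_init_self,
      PMF.pure_apply_self, mul_one, iidLaw, PMF.ofFintype_apply, iidLaw, PMF.ofFintype_apply,
      Fin.prod_univ_castSucc]
    · rfl
    · intro a _ ha
      rw [PMF.pure_apply_of_ne, mul_zero]
      intro h
      exact ha (by rw [h, Fin.snoc_last])
    · simp
    · intro v _ hv
      rw [PMF.bind_apply, tsum_fintype, Finset.sum_eq_zero, mul_zero]
      intro a _
      rw [PMF.pure_apply_of_ne, mul_zero]
      intro h
      exact hv (by rw [h, Fin.init_snoc])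
    · simp

theorem cost_tabulate_pick {n : ℕ} [NeZero n] (p : Fin n → ℝ) (r : ℕ) :
    (tabulate r fun _ => pick p).cost ≤ r * (n + 1) := by
  induction r with
  | zero => exact Nat.zero_le _
  | succ r ih =>
    refine (cost_bind_le (c := n + 1) (tabulate r fun _ => pick p) _ fun v => ?_).trans ?_
    · refine (cost_bind_le (c := 1) (pick p) _ fun a => le_rfl).trans ?_
      refine Nat.add_le_add_right ?_ 1
      rw [pick, cost]
      have : (Finset.univ.sup fun i : Fin n => (ret (R := ℝ) i).cost) ≤ 0 :=
        Finset.sup_le fun _ _ => le_rfl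
      omega
    · rw [add_mul, one_mul]
      exact Nat.add_le_add_right ih _

variable {α β : Type}

/-- The program draws `r` independent samples from `P` and returns a function of them that
satisfies `T`, in at most `c` steps. -/
def RunsSampled {n : ℕ} (P : PMF (Fin n)) (r : ℕ) (p : Prog ℝ α)
    (T : (Fin r → Fin n) → α → Prop) (c : ℕ) : Prop :=
  ∃ out : (Fin r → Fin n) → α, (∀ idx, T idx (out idx)) ∧ p.law = (iidLaw P r).map out ∧
    p.cost ≤ c

theorem RunsSampled.bind {n r : ℕ} {P : PMF (Fin n)} {p : Prog ℝ β} {v : β}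
    {f : β → Prog ℝ α} {T : (Fin r → Fin n) → α → Prop} {c c' : ℕ} (h : Evaluates p v c)
    (h' : RunsSampled P r (f v) T c') : RunsSampled P r (p >>= f) T (c + c') := by
  obtain ⟨out, h1, h2, h3⟩ := h'
  exact ⟨out, h1, h.law_bind_eq.trans h2, h.cost_bind_le.trans (Nat.add_le_add_left h3 c)⟩

theorem runsSampled_tabulate_pick {n r : ℕ} [NeZero n] (p : Fin n → ℝ)
    {f : (Fin r → Fin n) → Prog ℝ α} {T : (Fin r → Fin n) → α → Prop} {c : ℕ}
    (h : ∀ idx, Runs (f idx) (T idx) c) :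
    RunsSampled (draw p) r ((tabulate r fun _ => pick p) >>= f) T (r * (n + 1) + c) := by
  choose out h1 h2 using h
  refine ⟨out, h2, ?_, ?_⟩
  · rw [law_bind, law_tabulate_pick, PMF.map]
    congr 1
    ext1 idx
    exact (h1 idx).law_eq
  · exact (cost_bind_le _ _ fun idx => (h1 idx).cost_le).trans
      (Nat.add_le_add_right (cost_tabulate_pick p r) c)

end Sampling

/-! ### Correctness and cost of the search. -/

section Search

open Matrix

/-- The binary digits of `m`, as a vector. -/
noncomputable def digits (r m : ℕ) : Fin r → ℝ := fun j => if Nat.testBit m j then 1 else 0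

theorem image_digits (r : ℕ) : (fun m => digits r (m + 1)) '' {m | m < 2 ^ r - 1}
    = nonzeroBinary r := by
  ext x
  constructor
  · rintro ⟨m, hm, rfl⟩
    have hm : m < 2 ^ r - 1 := hm
    refine ⟨fun j => ?_, fun h => ?_⟩
    · simp only [digits]
      split_ifs <;> simp
    -- A nonzero number has a set bit, and its position is below `r` because `m + 1 < 2 ^ r`.
    · obtain ⟨i, hi⟩ := Nat.exists_testBit_of_ne_zero (Nat.succ_ne_zero m)
      have hir : i < r := by
        by_contra hcon
        have h1 : m + 1 < 2 ^ i :=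
          lt_of_lt_of_le (by omega) (Nat.pow_le_pow_right (by norm_num) (not_lt.1 hcon))
        rw [Nat.succ_eq_add_one, Nat.testBit_lt_two_pow h1] at hi
        exact absurd hi (by simp)
      have h1 := congrFun h ⟨i, hir⟩
      simp only [digits] at h1
      rw [if_pos hi] at h1
      exact one_ne_zero h1
  · rintro ⟨hx, hx0⟩
    classical
    set f : Fin r → Bool := fun j => decide (x j = 1) with hf
    have hdig : digits r (Nat.ofBits f) = x := by
      ext j
      simp only [digits, hf]
      rcases hx j with h | h <;> simp [h]
    have hne : Nat.ofBits f ≠ 0 := by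
      intro h
      refine hx0 ?_
      rw [Set.mem_singleton_iff, ← hdig, h]
      ext j
      simp [digits]
    refine ⟨Nat.ofBits f - 1, ?_, ?_⟩
    · have := Nat.ofBits_lt_two_pow f
      change Nat.ofBits f - 1 < 2 ^ r - 1
      omega
    · have h1 : Nat.ofBits f - 1 + 1 = Nat.ofBits f := by omega
      simpa only [h1] using hdig

theorem runs_leverage {n d : ℕ} (Q : Fin d → (Fin n → ℝ) × (Fin d → ℝ)) :
    Runs (leverage Q) (· = fun i => (∑ j, orthonormalFactor Q i j ^ 2) / (d : ℝ))
      (d * (3 * n + 3) + 1 + n * (5 * d + 3)) := by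
  refine Runs.mono ((runs_tabulate_eq fun j => (runs_dot _ _).bind_eq (runs_root _)).bind_eq
    ((runs_const d).bind_eq (runs_tabulate_eq
      (g := fun i => (∑ j, orthonormalFactor Q i j ^ 2) / (d : ℝ)) fun i =>
      (runs_tabulate_eq fun j => runs_divide _ _).bind_eq ((runs_dot _ _).bind_eq
        ((runs_divide _ _).mono le_rfl fun v hv => ?_))))) (le_of_eq (by ring)) fun _ h => h
  rw [hv, Rat.cast_natCast, dotProduct]
  congr 1
  exact Finset.sum_congr rfl fun j _ => (sq _).symm

/-- Taking the largest prescribed value on a repeated row keeps `x` nonzero: any `j` with `x' j = 1`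
forces `x (idx j) ≥ 1`. -/
theorem runs_rounding {n r : ℕ} (idx : Fin r → Fin n) (x' : Fin r → ℝ) (y : Fin n → ℝ) :
    Runs (rounding idx x' y) (fun x => x' ∈ nonzeroBinary r → IsRounding idx x' y x)
      (n * (2 * r + 4)) := by
  refine Runs.mono (runs_tabulate (Q := fun i v =>
      (i ∈ Set.range idx → ∃ j, idx j = i ∧ v = x' j) ∧
        (∀ j, idx j = i → x' j ≤ v) ∧
        (i ∉ Set.range idx → (y i < 1 / 2 → v = 0) ∧ (1 / 2 ≤ y i → v = 1)))
      (c := r * (1 + 1) + 3) fun i => ?_) (le_of_eq (by ring)) fun x hx hx' => ?_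
  -- Invariant: `none` means that row `i` has not occurred so far; `some v` means that `v` is an
  -- attained maximum of its values so far.
  · refine (runs_loop (fun k (acc : Option ℝ) =>
      (acc = none → ∀ j : Fin r, (j : ℕ) < k → idx j ≠ i) ∧
      ∀ v, acc = some v → (∃ j, idx j = i ∧ v = x' j) ∧
        ∀ j : Fin r, (j : ℕ) < k → idx j = i → x' j ≤ v) (c := 1) ?_ ?_).bind ?_
    · simp
    · intro j acc hacc
      split_ifs with hj
      · cases acc with
        | none =>
          refine (runs_ret ?_).mono (Nat.zero_le _) fun _ h => h
          refine ⟨by simp, fun v hv => ?_⟩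
          obtain rfl : x' j = v := Option.some_injective _ hv
          refine ⟨⟨j, hj, rfl⟩, fun k hk hki => ?_⟩
          rcases Nat.lt_succ_iff_lt_or_eq.1 hk with h | h
          · exact absurd hki (hacc.1 rfl k h)
          · rw [Fin.ext h]
        | some u =>
          obtain ⟨hu, hmax⟩ := hacc.2 u rfl
          refine Runs.mono ((runs_lt u (x' j)).bind (c' := 0) fun b hb => ?_) le_rfl fun _ h => h
          cases b with
          | true =>
            have hlt : u < x' j := by simpa using hb
            refine runs_ret ⟨by simp, fun v hv => ?_⟩
            obtain rfl : x' j = v := Option.some_injective _ hv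
            refine ⟨⟨j, hj, rfl⟩, fun k hk hki => ?_⟩
            rcases Nat.lt_succ_iff_lt_or_eq.1 hk with h | h
            · exact (hmax k h hki).trans hlt.le
            · rw [Fin.ext h]
          | false =>
            have hge : x' j ≤ u := by simpa using hb
            refine runs_ret ⟨by simp, fun v hv => ?_⟩
            obtain rfl : u = v := Option.some_injective _ hv
            refine ⟨hu, fun k hk hki => ?_⟩
            rcases Nat.lt_succ_iff_lt_or_eq.1 hk with h | h
            · exact hmax k h hki
            · rwa [Fin.ext h]
      · refine (runs_ret ?_).mono (Nat.zero_le _) fun _ h => h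
        refine ⟨fun h k hk => ?_, fun v hv => ⟨(hacc.2 v hv).1, fun k hk hki => ?_⟩⟩
        · rcases Nat.lt_succ_iff_lt_or_eq.1 hk with h' | h'
          · exact hacc.1 h k h'
          · rwa [Fin.ext h']
        · rcases Nat.lt_succ_iff_lt_or_eq.1 hk with h' | h'
          · exact (hacc.2 v hv).2 k h' hki
          · exact absurd (Fin.ext h' ▸ hki) hj
    · intro acc hacc
      cases acc with
      | some v =>
        obtain ⟨⟨j, hj, hv⟩, hmax⟩ := hacc.2 v rfl
        refine (runs_ret ?_).mono (Nat.zero_le _) fun _ h => h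
        exact ⟨fun _ => ⟨j, hj, hv⟩, fun k hk => hmax k k.2 hk, fun hi => absurd ⟨j, hj⟩ hi⟩
      | none =>
        have hnone : ∀ j, idx j ≠ i := fun j => hacc.1 rfl j j.2
        have hni : i ∉ Set.range idx := by
          rintro ⟨j, hj⟩
          exact hnone j hj
        refine Runs.mono ((runs_const (1 / 2)).bind_eq ((runs_lt _ _).bind (c' := 1)
          fun b hb => ?_)) (by omega) fun _ h => h
        have hhalf : ((1 / 2 : ℚ) : ℝ) = 1 / 2 := by norm_num
        rw [hhalf] at hb
        cases b with
        | true =>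
          have hlt : y i < 1 / 2 := hb.1 rfl
          refine (runs_const 0).mono le_rfl fun v hv => ?_
          refine ⟨fun h => absurd h hni, fun j hj => absurd hj (hnone j), fun _ =>
            ⟨fun _ => by simpa using hv, fun h => absurd hlt (not_lt.2 h)⟩⟩
        | false =>
          have hge : ¬ y i < 1 / 2 := fun h => absurd (hb.2 h) (by simp)
          refine (runs_const 1).mono le_rfl fun v hv => ?_
          refine ⟨fun h => absurd h hni, fun j hj => absurd hj (hnone j), fun _ =>
            ⟨fun h => absurd h hge, fun _ => by simpa using hv⟩⟩
  · refine ⟨fun i hi => (hx i).1 hi, fun i hi => ((hx i).2.2 hi).1, fun i hi => ((hx i).2.2 hi).2,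
      fun h0 => hx'.2 ?_⟩
    ext j
    refine (hx'.1 j).resolve_right fun h1 => ?_
    have h2 := (hx (idx j)).2.1 j rfl
    rw [h0, h1] at h2
    exact absurd h2 (by norm_num)

theorem rescaled_eq_of {n d r : ℕ} (P : PMF (Fin n)) (idx : Fin r → Fin n)
    (A : Matrix (Fin n) (Fin d) ℝ) : rescalingMatrix P idx * samplingMatrix idx * A
      = Matrix.of fun j k => 1 / Real.sqrt (r * (P (idx j)).toReal) * A (idx j) k := by
  ext j k
  rw [Matrix.mul_assoc, rescalingMatrix, diagonal_mul]
  simp [samplingMatrix, Matrix.mul_apply]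

theorem search_body_cost {n d r : ℕ} (hd : 1 ≤ d) (hdn : d ≤ n) (hdr : d ≤ r) :
    r * 2 + (r * 2 + (d * (6 * r + 3 * d + 8) + (n * (3 * d + 2) + (n * (2 * r + 4)
      + (28 * (d * n) + 1))))) + 1 ≤ 80 * (n * r) := by
  have h1 : d * r ≤ n * r := Nat.mul_le_mul_right r hdn
  have h2 : d * d ≤ n * r := Nat.mul_le_mul hdn hdr
  have h3 : n * d ≤ n * r := Nat.mul_le_mul_left n hdr
  have h4 : n ≤ n * r := Nat.le_mul_of_pos_right n (by omega)
  have h5 : r ≤ n * r := Nat.le_mul_of_pos_left r (by omega)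
  nlinarith

/-- Apart from the loop, the terms not of order `n r` are cubic, such as `d² n`; they are absorbed
because `d ≤ r < 2 ^ r` and `d ≤ n`. -/
theorem attack_cost {n d r : ℕ} (hd : 1 ≤ d) (hdn : d ≤ n) (hdr : d ≤ r) :
    14 * (d * d * (n + d)) + (d * (3 * n + 3) + 1 + n * (5 * d + 3) + (r * (n + 1) +
      (1 + (r * 5 + (r * (d * 2 + 1) + (14 * (d * d * (r + d)) + (n * 2 + (28 * (d * n) +
        ((2 ^ r - 1) * (80 * (n * r)) + 0))))))))) ≤ 300 * (n * r * 2 ^ r) := by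
  set T := 2 ^ r with hT
  have hrT : r < T := Nat.lt_two_pow_self
  have h0 : n * r ≤ n * r * T := Nat.le_mul_of_pos_right _ (by omega)
  have h1 : d * r ≤ n * r := Nat.mul_le_mul_right r hdn
  have h3 : n * d ≤ n * r := Nat.mul_le_mul_left n hdr
  have h4 : n ≤ n * r := Nat.le_mul_of_pos_right n (by omega)
  have h5 : r ≤ n * r := Nat.le_mul_of_pos_left r (by omega)
  have h6 : d * d * n ≤ n * r * T := by
    calc d * d * n ≤ r * T * n := Nat.mul_le_mul_right n (Nat.mul_le_mul hdr (by omega))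
      _ = n * r * T := by ring
  have h7 : d * d * r ≤ n * r * T := by
    calc d * d * r ≤ n * T * r :=
          Nat.mul_le_mul_right r (Nat.mul_le_mul hdn (by omega))
      _ = n * r * T := by ring
  have h8 : d * d * d ≤ d * d * n := Nat.mul_le_mul_left _ hdn
  have h9 : (T - 1) * (80 * (n * r)) ≤ T * (80 * (n * r)) :=
    Nat.mul_le_mul_right _ (Nat.sub_le _ _)
  nlinarith

theorem attack_runsSampled {n d : ℕ} [NeZero n] {A : Matrix (Fin n) (Fin d) ℝ} (hd : 1 ≤ d)
    (hA : A.rank = d) {r : ℕ} (hr : d ≤ r) :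
    ∃ P, IsLeverageDist A P ∧
      RunsSampled P r (attack A r) (IsSearchOutput A P) (300 * (n * r * 2 ^ r)) := by
  have hdn : d ≤ n := hA.symm.le.trans A.rank_le_height
  obtain ⟨Q, hQe, hQ⟩ := runs_factorize hd A
  obtain ⟨p, hpe, hp⟩ := runs_leverage Q
  obtain ⟨hU, hN⟩ := hQ.exists_orthonormal hA
  have hlev := draw_leverage hd hA hU hN
  rw [← hp] at hlev
  obtain ⟨hP, hPlev⟩ := hlev
  have hP : ∀ i, (draw p i).toReal = p i := fun i => by rw [hP, hp]
  refine ⟨draw p, hPlev, ?_⟩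
  suffices h : RunsSampled (draw p) r (attack A r) (IsSearchOutput A (draw p)) _ by
    obtain ⟨out, h1, h2, h3⟩ := h
    exact ⟨out, h1, h2, h3.trans (attack_cost hd hdn hr)⟩
  refine RunsSampled.bind hQe (RunsSampled.bind hpe
    (runsSampled_tabulate_pick p fun idx => ?_))
  set D : Fin r → ℝ := fun j => 1 / Real.sqrt (r * p (idx j)) with hD
  have hDb : ∀ x' : Fin r → ℝ,
      (fun j => D j * x' j) = (rescalingMatrix (draw p) idx).mulVec x' := by
    intro x'
    ext j
    rw [rescalingMatrix, mulVec_diagonal, hP]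
  have hDA : (Matrix.of fun j k => D j * A (idx j) k)
      = rescalingMatrix (draw p) idx * samplingMatrix idx * A := by
    simp only [rescaled_eq_of, hP, hD]
  refine (runs_const r).bind_eq ((runs_tabulate_eq (g := D) (c := 4) fun j => ?_).bind_eq
    ((runs_tabulate_eq fun j =>
        runs_tabulate_eq fun k => runs_times _ _).bind_eq ((runs_factorize hd _).bind
          fun Q' hQ' => ?_)))
  · refine Runs.mono ((runs_times _ _).bind_eq ((runs_root _).bind_eq ((runs_const 1).bind_eq
      (runs_divide _ _)))) le_rfl fun v hv => ?_
    rw [hv, Rat.cast_natCast, Rat.cast_one]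
  rw [hDA] at hQ'
  have he : Runs (tabulate n fun i => if i = 0 then const 1 else const 0)
      (· = (Pi.single 0 1 : Fin n → ℝ)) (n * 2) := by
    refine runs_tabulate_eq fun i => ?_
    split_ifs with h
    · subst h
      simpa using runs_const 1
    · simpa [h] using runs_const 0
  -- The regression solutions and roundings are fixed as functions of `x'` before the loop is
  -- analysed, since `IsSearchOutput` asks for such functions.
  choose w hwe hw using fun x' : Fin r → ℝ =>
    runs_regress hQ' ((rescalingMatrix (draw p) idx).mulVec x')
  choose x hxe hx using fun x' : Fin r → ℝ => runs_rounding idx x' (A *ᵥ w x')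
  set e : Fin n → ℝ := Pi.single 0 1 with hedef
  -- The candidates seen after `k` rounds. Round `m` uses the digits of `m + 1`, which skips the
  -- zero vector.
  set S : ℕ → Set (Fin n → ℝ) := fun k =>
    insert e (x '' ((fun m => digits r (m + 1)) '' {m | m < k})) with hS
  have hSsucc : ∀ k, S (k + 1) = insert (x (digits r (k + 1))) (S k) := by
    intro k
    have : {m | m < k + 1} = insert k {m | m < k} := by
      ext m
      simp only [Set.mem_ofPred_eq, Set.mem_insert_iff]
      omega
    rw [hS]
    simp only [this, Set.image_insert_eq]
    exact Set.insert_comm _ _ _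
  refine he.bind_eq ((runs_spanDist hd hdn hQ e).bind_eq (Runs.bind (Runs.mono (runs_loop
    (fun k best => best.2 = colDistSq A best.1 ∧ best.1 ∈ S k ∧
      ∀ y ∈ S k, best.2 ≤ colDistSq A y) (c := _) ?_ fun m best hbest => ?_)
    (Nat.mul_le_mul_left _ (search_body_cost hd hdn hr)) fun _ h => h) fun best hbest => ?_))
  · refine ⟨rfl, Set.mem_insert _ _, fun y hy => ?_⟩
    have : S 0 = {e} := by simp [hS]
    rw [this] at hy
    rw [Set.mem_singleton_iff.1 hy]
  · have hdig : Runs (tabulate r fun j : Fin r =>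
        if Nat.testBit (m + 1) j then const 1 else const 0)
        (· = digits r (m + 1)) (r * 2) := by
      refine runs_tabulate_eq fun j => ?_
      simp only [digits]
      split_ifs
      · simpa using runs_const 1
      · simpa using runs_const 0
    refine hdig.bind_eq ((runs_tabulate_eq fun j => runs_times _ _).bind_eq ?_)
    rw [hDb]
    refine (hwe _).runs.bind_eq ((runs_matVec A _).bind_eq ((hxe _).runs.bind_eq
      ((runs_spanDist hd hdn hQ _).bind_eq (((runs_lt _ _).bind (c' := 0) fun b hb => ?_).mono
        le_rfl fun _ h => h))))
    rw [hSsucc]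
    obtain ⟨hb1, hb2, hb3⟩ := hbest
    cases b with
    | true =>
      have hlt := hb.1 rfl
      refine runs_ret ⟨rfl, Set.mem_insert _ _, fun y hy => ?_⟩
      rcases hy with rfl | hy
      · exact le_rfl
      · exact hlt.le.trans (hb3 y hy)
    | false =>
      have hge := not_lt.1 fun h => absurd (hb.2 h) (by simp)
      refine runs_ret ⟨hb1, Set.mem_insert_of_mem _ hb2, fun y hy => ?_⟩
      rcases hy with rfl | hy
      · exact hge
      · exact hb3 y hy
  · obtain ⟨hb1, hb2, hb3⟩ := hbest
    simp only [hS, image_digits] at hb2 hb3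
    refine runs_ret ⟨w, x, fun x' hx' => ⟨hw x', hx x' hx'⟩, hb2, fun y hy => ?_⟩
    change colDistSq A best.1 ≤ colDistSq A y
    rw [← hb1]
    exact hb3 y hy

end Search

end Prog

/-! ### The constants and the final theorem. -/

theorem exists_pow_two_log_bound {d : ℕ} (hd : 1 ≤ d) :
    ∃ p : ℕ, 12 * d ≤ 2 ^ p ∧ (p : ℝ) + 1 ≤ 14 * Real.log (d + 1) := by
  -- Since `d < 2 ^ (Nat.log 2 d + 1)`, four further doublings cover the factor `12`. As `log 2 ≥ 1
  -- / 2`, both `Nat.log 2 d ≤ 2 log (d + 1)` and `6 ≤ 12 log (d + 1)`, which makes `14`.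
  refine ⟨Nat.log 2 d + 5, ?_, ?_⟩
  · have h1 := Nat.lt_pow_succ_log_self (b := 2) (by norm_num) d
    have h2 : 2 ^ (Nat.log 2 d + 5) = 16 * 2 ^ (Nat.log 2 d).succ := by
      rw [Nat.succ_eq_add_one, pow_add, pow_add]
      ring
    omega
  · have hdR : (1 : ℝ) ≤ d := by exact_mod_cast hd
    have hlog2 : 1 / 2 ≤ Real.log 2 := by
      have := Real.log_two_gt_d9
      linarith
    have h1 : Real.log 2 ≤ Real.log (d + 1) :=
      Real.log_le_log (by norm_num) (by linarith)
    have h2 : (Nat.log 2 d : ℝ) * Real.log 2 ≤ Real.log (d + 1) := by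
      rw [← Real.log_pow]
      refine Real.log_le_log (by positivity) ?_
      have : ((2 ^ Nat.log 2 d : ℕ) : ℝ) ≤ d := by
        exact_mod_cast Nat.pow_log_le_self 2 (by omega)
      push_cast at this
      linarith
    have h3 : (0 : ℝ) ≤ Nat.log 2 d := Nat.cast_nonneg _
    push_cast
    nlinarith

theorem theorem4 :
    ∃ C K : ℝ, 0 < C ∧ 0 < K ∧
      ∀ (n d : ℕ) [NeZero n] (A : Matrix (Fin n) (Fin d) ℝ), 1 ≤ d → A.rank = d →
        (∀ ε : ℝ, 0 < ε → ∀ r : ℕ, C * (d * Real.log (d + 1)) / (min ε 1) ^ 2 ≤ r →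
          d ≤ r ∧
          ∀ xopt ∈ nonzeroBinary n, IsMinOn (colDistSq A) (nonzeroBinary n) xopt →
            ∀ μ : PMF (Fin n → ℝ), IsAttackLaw A r μ →
              2 / 3 ≤ μ.toOuterMeasure {xs | xs ∈ nonzeroBinary n ∧
                colDistSq A xs ≤ (1 + ε) * colDistSq A xopt}) ∧
        (∀ r : ℕ, d ≤ r →
          IsAttackLaw A r (Prog.attack A r).law ∧
          ((Prog.attack A r).cost : ℝ) ≤ K * (n * r * 2 ^ r)) := by
  -- `4000` exceeds `32 * 14`, for the Gram matrix, and `4000 * (1 / 2)` exceeds `1536`, for the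
  -- residual, with `log (d + 1) ≥ 1 / 2`. The constant `300` is that of `attack_cost`.
  refine ⟨4000, 300, by norm_num, by norm_num, fun n d _ A hd hA => ⟨fun ε hε r hr => ?_,
    fun r hr => ?_⟩⟩
  · have hdR : (1 : ℝ) ≤ d := by exact_mod_cast hd
    have hlog : 1 / 2 ≤ Real.log (d + 1) := by
      have h1 := Real.log_two_gt_d9
      have h2 : Real.log 2 ≤ Real.log (d + 1) :=
        Real.log_le_log (by norm_num) (by linarith)
      linarith
    obtain ⟨p, hp, hpl⟩ := exists_pow_two_log_bound hd
    set η := min ε 1 with hη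
    have hη0 : 0 < η := lt_min hε one_pos
    have hη1 : η ≤ 1 := min_le_right _ _
    have hηε : η ≤ ε := min_le_left _ _
    rw [div_le_iff₀ (by positivity)] at hr
    have hrR : (0 : ℝ) ≤ r := Nat.cast_nonneg r
    -- Since `η ≤ 1`, the square may be weakened to the first power, which is all that the
    -- probabilistic bounds need.
    have hr1 : 4000 * (d * Real.log (d + 1)) ≤ r * η := by
      refine hr.trans (mul_le_mul_of_nonneg_left ?_ hrR)
      nlinarith
    have hr2 : (r : ℝ) * η ≤ r := mul_le_of_le_one_right hrR hη1
    have hr3 : (r : ℝ) * η ≤ r * ε := mul_le_mul_of_nonneg_left hηε hrR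
    have hdlog : (d : ℝ) * (1 / 2) ≤ d * Real.log (d + 1) :=
      mul_le_mul_of_nonneg_left hlog (by linarith)
    refine ⟨?_, fun xopt hx _ μ hμ => hμ.two_thirds_le hd hA hε hp ?_ ?_ hx⟩
    · have : (d : ℝ) ≤ r := by linarith
      exact_mod_cast this
    · have h1 : (d : ℝ) * (p + 1) ≤ d * (14 * Real.log (d + 1)) :=
        mul_le_mul_of_nonneg_left hpl (by linarith)
      linarith
    · linarith
  · obtain ⟨P, hP, out, h1, h2, h3⟩ := Prog.attack_runsSampled hd hA hr
    refine ⟨⟨P, hP, out, fun idx _ => h1 idx, h2⟩, ?_⟩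
    exact_mod_cast h3
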